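/- Let $\xi_j$ ($j\in\mathbb Z$) be random points in $\mathbb R^d$ such that $\sum_{j\in\mathbb Z}\delta_{\xi_j}$ is a homogeneous Poisson process of rate $\lambda\in(0,\infty)$, let $\{Y_t,t\ge 0\}$ be a random process in $\mathbb R^d$ with $Y_0=0$, and let $\{Y^{(j)}_t,t\ge0\}$, $j\in\mathbb Z$, be independent copies of it, the family $(Y^{(j)})_j$ being independent of $(\xi_j)_j$. Let $B\subset\mathbb R^d$ be a compact set with non-empty interior, and let $$N(t)=\sum_{j\in\mathbb Z}\mathbf 1\{\xi_j+Y^{(j)}_t\in B\},\qquad t\ge 0,$$ be the associated Smoluchowski process; assume that it is (jointly) measurable and strictly stationary. Put $\rho=\lambda\,\mathrm{vol}(B)$, $B(x)=\{z-x: z\in B\}$, $$U(t_1,\dots,t_k)=\frac1{\mathrm{vol}(B)}\,\mathbb E\,\mathrm{vol}\Big(\bigcap_{i=1}^k B(Y_{t_i})\Big),\qquad H(t)=H(-t)=\frac1{\mathrm{vol}(B)}\,\mathbb E\,\mathrm{vol}\big(B\cap B(Y_t)\big)\quad(t\ge0),$$ $R(t)=\mathrm{cov}\{N(0),N(t)\}$,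 and, for $0\le t<T$, $$\hat R(t)=\frac1{T-t}\int_0^{T-t}(N(u)-\rho)(N(t+u)-\rho)\,du .$$ Then all the integrals and expectations below exist (the path integral defining $\hat R(t)$ almost surely, and $\hat R(t)-R(t)$ is square integrable), and for all $0\le t<T$ and $0\le s<T$ $$\begin{aligned}(T-s)(T-t)\,\mathbb E\big[(\hat R(t)-R(t))(\hat R(s)-R(s))\big] ={}&\rho^2\int_0^{T-s}\!\!\int_0^{T-t}\big[H(\tau_1-\tau_2)H(\tau_1-\tau_2+t-s)+H(\tau_1-\tau_2-s)H(\tau_1-\tau_2+t)\big]\,d\tau_1\,d\tau_2\\ &+\rho\int_0^{T-s}\!\!\int_0^{T-t}U(\tau_1,\tau_1+t,\tau_2,\tau_2+s)\,d\tau_1\,d\tau_2 .\end{aligned}$$ In particular, there is an absolute constant $C$ such that for all $0\le t<T$ $$\mathbb E|\hat R(t)-R(t)|^2\le\frac{C(\rho^2+\rho)}{T-t}\int_0^T H(y)\,dy .$$ -/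

import Mathlib

open MeasureTheory ProbabilityTheory
open scoped NNReal ENNReal

namespace Smoluchowski

noncomputable section

/-- The translate `B(x) = {z - x : z ∈ B}`. -/
def shift {d : ℕ} (B : Set (EuclideanSpace ℝ (Fin d))) (x : EuclideanSpace ℝ (Fin d)) :
    Set (EuclideanSpace ℝ (Fin d)) :=
  {y | ∃ z ∈ B, y = z - x}

/-- The point process `Ξ = ∑ⱼ ε_{ξⱼ}`, a random measure. -/
def pointProcess {d : ℕ} {Ω : Type*} (ξ : ℤ → Ω → EuclideanSpace ℝ (Fin d)) (ω : Ω) :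
    Measure (EuclideanSpace ℝ (Fin d)) :=
  Measure.sum fun j => Measure.dirac (ξ j ω)

/-- `Ξ = ∑ⱼ ε_{ξⱼ}` is a homogeneous Poisson process of rate `lam` on `ℝᵈ`: the number of points in
a Borel set of finite volume is Poisson distributed with mean `lam * vol A`, and the numbers of
points in disjoint sets are independent. -/
structure IsHomogeneousPoisson {d : ℕ} {Ω : Type*} [MeasurableSpace Ω] (P : Measure Ω)
    (lam : ℝ≥0) (ξ : ℤ → Ω → EuclideanSpace ℝ (Fin d)) : Prop where
  measurable : ∀ j, Measurable (ξ j)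
  hasLaw : ∀ A : Set (EuclideanSpace ℝ (Fin d)), MeasurableSet A → volume A ≠ ∞ →
    HasLaw (fun ω => pointProcess ξ ω A)
      ((poissonMeasure (lam * (volume A).toNNReal)).map (fun n : ℕ => (n : ℝ≥0∞))) P
  indep : ∀ (n : ℕ) (A : Fin n → Set (EuclideanSpace ℝ (Fin d))),
    (∀ i, MeasurableSet (A i)) → (∀ i, volume (A i) ≠ ∞) →
    Pairwise (fun i j => Disjoint (A i) (A j)) →
    iIndepFun (fun i ω => pointProcess ξ ω (A i)) P

/-- The system of moving particles: initial positions `ξⱼ` forming a homogeneous Poisson process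
of rate `lam`, and displacement processes `Yp j`, which are independent copies of the generic
displacement process `Y` (living on `Ω'`, with `Y 0 = 0`) and independent of the initial
positions. -/
structure IsParticleSystem {d : ℕ} {Ω Ω' : Type*} [MeasurableSpace Ω] [MeasurableSpace Ω']
    (P : Measure Ω) (P' : Measure Ω') (lam : ℝ≥0)
    (Y : ℝ≥0 → Ω' → EuclideanSpace ℝ (Fin d))
    (ξ : ℤ → Ω → EuclideanSpace ℝ (Fin d))
    (Yp : ℤ → ℝ≥0 → Ω → EuclideanSpace ℝ (Fin d)) : Prop where
  poisson : IsHomogeneousPoisson P lam ξ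
  measurable_generic : ∀ t, Measurable (Y t)
  generic_zero : ∀ᵐ ω ∂P', Y 0 ω = 0
  measurable_copy : ∀ j t, Measurable (Yp j t)
  identDistrib : ∀ j, IdentDistrib (fun ω t => Yp j t ω) (fun ω t => Y t ω) P P'
  iIndep_copies : iIndepFun (fun j ω t => Yp j t ω) P
  indep_initial : IndepFun (fun ω j => ξ j ω) (fun ω j t => Yp j t ω) P

/-- The Smoluchowski process `N(t) = ∑ⱼ 1{ξⱼ + Yⱼ(t) ∈ B}`. -/
def N {d : ℕ} {Ω : Type*} (B : Set (EuclideanSpace ℝ (Fin d)))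
    (ξ : ℤ → Ω → EuclideanSpace ℝ (Fin d))
    (Yp : ℤ → ℝ≥0 → Ω → EuclideanSpace ℝ (Fin d)) (t : ℝ≥0) (ω : Ω) : ℝ :=
  (∑' j : ℤ, B.indicator (fun _ => (1 : ℝ≥0∞)) (ξ j ω + Yp j t ω)).toReal

/-- Strict stationarity of a process on `[0, ∞)`: its finite dimensional distributions are
invariant under time shifts. -/
def IsStrictlyStationary {Ω : Type*} [MeasurableSpace Ω] (P : Measure Ω)
    (Z : ℝ≥0 → Ω → ℝ) : Prop :=
  ∀ (n : ℕ) (t : Fin n → ℝ≥0) (τ : ℝ≥0),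
    IdentDistrib (fun ω i => Z (t i + τ) ω) (fun ω i => Z (t i) ω) P P

/-- `ρ = lam * vol B`, the mean of `N(t)`. -/
def rho {d : ℕ} (lam : ℝ≥0) (B : Set (EuclideanSpace ℝ (Fin d))) : ℝ :=
  lam * volume.real B

/-- `U(t₁, …, tₖ) = E vol(B(Y_{t₁}) ∩ … ∩ B(Y_{tₖ})) / vol B`. -/
def U {d : ℕ} {Ω' : Type*} [MeasurableSpace Ω'] (P' : Measure Ω')
    (B : Set (EuclideanSpace ℝ (Fin d))) (Y : ℝ≥0 → Ω' → EuclideanSpace ℝ (Fin d))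
    {k : ℕ} (t : Fin k → ℝ≥0) : ℝ :=
  (1 / volume.real B) * ∫ ω, volume.real (⋂ i, shift B (Y (t i) ω)) ∂P'

/-- `H(t) = E vol(B ∩ B(Y_t)) / vol B` for `t ≥ 0`, extended to the real line by
`H(-t) = H(t)`. -/
def H {d : ℕ} {Ω' : Type*} [MeasurableSpace Ω'] (P' : Measure Ω')
    (B : Set (EuclideanSpace ℝ (Fin d))) (Y : ℝ≥0 → Ω' → EuclideanSpace ℝ (Fin d))
    (t : ℝ) : ℝ :=
  (1 / volume.real B) * ∫ ω, volume.real (B ∩ shift B (Y (Real.nnabs t) ω)) ∂P'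

/-- The covariance function `R(t) = cov(Z(0), Z(t))` of a stationary process `Z` on `[0, ∞)`, at a
lag `t ≥ 0`. -/
def R {Ω : Type*} [MeasurableSpace Ω] (P : Measure Ω) (Z : ℝ≥0 → Ω → ℝ) (t : ℝ) : ℝ :=
  cov[Z 0, Z t.toNNReal; P]

/-- The integrand `(Z(u) - m) (Z(t + u) - m)` of the empirical covariance (`u, t ≥ 0`). -/
def empIntegrand {Ω : Type*} (Z : ℝ≥0 → Ω → ℝ) (m t : ℝ) (ω : Ω) (u : ℝ) : ℝ :=
  (Z u.toNNReal ω - m) * (Z (t + u).toNNReal ω - m)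

/-- The empirical covariance
`R̂(t) = (T - t)⁻¹ ∫₀^{T-t} (Z(u) - m) (Z(t + u) - m) du`, for `0 ≤ t < T`. -/
def Rhat {Ω : Type*} (Z : ℝ≥0 → Ω → ℝ) (m T t : ℝ) (ω : Ω) : ℝ :=
  (1 / (T - t)) * ∫ u in (0 : ℝ)..(T - t), empIntegrand Z m t ω u

end

end Smoluchowski

open Smoluchowski

/-!
The points of the Poisson process, marked by their paths, have product measures as factorial moment
measures. A product of values `N(t₁) ⋯ N(tₖ)` is a sum over all `k`-tuples of particles; grouping
the positions of a tuple that carry the same particle turns its expectation into the sum, over the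
set partitions of `{t₁, …, tₖ}`, of the products of `ρ U(block)`. In other words the joint
cumulants of `N` are `ρ U`. Centering removes the partitions with a singleton block, so a fourth
central moment consists of the three pairings and of the single block of length four. One of the
pairings is `R(t) R(s)`; integrating the remaining terms over the rectangle
`[0, T - t] × [0, T - s]` gives the covariance of the errors.

For the mean squared error, bound one factor of each pairing by `H(0) ≤ 1`, and the block of length
four by `H(τ₁ - τ₂)`. What is left is `H` at a shift of `τ₁ - τ₂` by at most `t`, and for fixed `τ₂`
these arguments stay in `[-T, T]`.
-/

namespace Smoluchowski

section DistinctSums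

/-- The sum of `∏ i, a i (e i)` over all `k`-tuples `e` of pairwise distinct indices. -/
noncomputable def distinctSum {ι : Type*} {k : ℕ} (a : Fin k → ι → ℝ≥0∞) : ℝ≥0∞ :=
  ∑' e : Fin k ↪ ι, ∏ i, a i (e i)

theorem tsum_eq_sum_embedding_add {ι : Type*} {k : ℕ} (d : ι → ℝ≥0∞) (e : Fin k ↪ ι) :
    ∑' j, d j = ∑ i, d (e i) + ∑' l : {l // l ∉ Set.range e}, d l := by
  have h := (ENNReal.summable (f := fun j : Set.range e => d j)).tsum_add_tsum_compl
    (f := d) (s := Set.range e) ENNReal.summable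
  rw [← h]
  congr 1
  rw [← (Equiv.ofInjective e e.injective).tsum_eq, tsum_fintype]
  rfl

theorem tsum_mul_distinctSum {ι : Type*} {k : ℕ} (d : ι → ℝ≥0∞) (a : Fin k → ι → ℝ≥0∞) :
    (∑' j, d j) * distinctSum a =
      distinctSum (Fin.cons d a : Fin (k + 1) → ι → ℝ≥0∞) +
        ∑ i, distinctSum (Function.update a i (d * a i)) := by
  have hcons : distinctSum (Fin.cons d a : Fin (k + 1) → ι → ℝ≥0∞) =
      ∑' e : Fin k ↪ ι, ∑' l : {l // l ∉ Set.range e}, d l * ∏ i, a i (e i) := by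
    unfold distinctSum
    rw [← (Equiv.embeddingFinSucc k ι).symm.tsum_eq, ENNReal.tsum_sigma']
    refine tsum_congr fun e => tsum_congr fun l => ?_
    rw [Equiv.coe_embeddingFinSucc_symm, Fin.prod_univ_succ]
    simp
  have hupdate : ∀ i, distinctSum (Function.update a i (d * a i)) =
      ∑' e : Fin k ↪ ι, d (e i) * ∏ l, a l (e l) := by
    intro i
    refine tsum_congr fun e => ?_
    have hblock : ∀ l, Function.update a i (d * a i) l (e l) =
        (if l = i then d (e l) else 1) * a l (e l) := by
      intro l
      by_cases hl : l = i
      · subst hl; simp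
      · simp [hl]
    simp_rw [hblock, Finset.prod_mul_distrib]
    simp
  simp_rw [hcons, hupdate]
  rw [← Summable.tsum_finsetSum fun _ _ => ENNReal.summable, ← ENNReal.tsum_add, distinctSum,
    ← ENNReal.tsum_mul_left]
  refine tsum_congr fun e => ?_
  rw [tsum_eq_sum_embedding_add d e, add_mul, Finset.sum_mul, ENNReal.tsum_mul_right, add_comm]

@[simp]
theorem distinctSum_fin_zero {ι : Type*} (a : Fin 0 → ι → ℝ≥0∞) : distinctSum a = 1 := by
  simp [distinctSum]

theorem distinctSum_eq_zero {ι : Type*} {k : ℕ} (a : Fin k → ι → ℝ≥0∞) {i : Fin k}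
    (h : a i = 0) : distinctSum a = 0 := by
  simp only [distinctSum, ENNReal.tsum_eq_zero]
  exact fun e => Finset.prod_eq_zero (Finset.mem_univ i) (by simp [h])

theorem distinctSum_eq_prod {ι : Type*} {k : ℕ} (a : Fin k → ι → ℝ≥0∞)
    (h : Pairwise fun i j => a i * a j = 0) : distinctSum a = ∏ i, ∑' j, a i j := by
  induction k with
  | zero => simp
  | succ k ih =>
    have hmul := tsum_mul_distinctSum (a 0) (Fin.tail a)
    rw [Finset.sum_eq_zero, add_zero, Fin.cons_self_tail, ih] at hmul
    · rw [← hmul, Fin.prod_univ_succ]; rfl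
    · exact fun i j hij => h fun hs => hij (Fin.succ_injective _ hs)
    · intro i _
      refine distinctSum_eq_zero _ (i := i) ?_
      rw [Function.update_self]
      exact h (Fin.succ_ne_zero i).symm

/-- The sum of `∏ κ(block)` over the partitions obtained from the blocks `a 0, …, a (k - 1)` by
letting each element of the list either join an existing block or open a new one. In particular
`partitionSum κ L ![]` is the sum over all set partitions of `L`, the formula expressing moments by
the joint cumulants `κ`. -/
def partitionSum {α R : Type*} [CommSemiring R] (κ : List α → R) :
    List α → {k : ℕ} → (Fin k → List α) → R
  | [], _, a => ∏ i, κ (a i)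
  | t :: L, k, a =>
    partitionSum κ L (Fin.cons [t] a : Fin (k + 1) → List α) +
      ∑ i, partitionSum κ L (Function.update a i (t :: a i))

theorem partitionSum_ne_top {α : Type*} {κ : List α → ℝ≥0∞} (hκ : ∀ t l, κ (t :: l) ≠ ∞)
    (L : List α) {k : ℕ} (a : Fin k → List α) (ha : ∀ i, κ (a i) ≠ ∞) :
    partitionSum κ L a ≠ ∞ := by
  induction L generalizing k with
  | nil => exact ENNReal.prod_ne_top fun i _ => ha i
  | cons t L ih =>
    exact ENNReal.add_ne_top.2 ⟨ih _ (Fin.cases (hκ t []) ha), ENNReal.sum_ne_top.2 fun i _ =>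
      ih _ ((Function.forall_update_iff a fun _ l => κ l ≠ ∞).2 ⟨hκ t _, fun l _ => ha l⟩)⟩

theorem toReal_partitionSum {α : Type*} {κ : List α → ℝ≥0∞} (hκ : ∀ t l, κ (t :: l) ≠ ∞)
    (L : List α) {k : ℕ} (a : Fin k → List α) (ha : ∀ i, κ (a i) ≠ ∞) :
    (partitionSum κ L a).toReal = partitionSum (fun l => (κ l).toReal) L a := by
  induction L generalizing k with
  | nil => exact ENNReal.toReal_prod ..
  | cons t L ih =>
    have hcons : ∀ i, κ ((Fin.cons [t] a : Fin (k + 1) → List α) i) ≠ ∞ := Fin.cases (hκ t []) ha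
    have hupdate : ∀ i l, κ (Function.update a i (t :: a i) l) ≠ ∞ := fun i =>
      (Function.forall_update_iff a fun _ l => κ l ≠ ∞).2 ⟨hκ t _, fun l _ => ha l⟩
    have hne := fun i => partitionSum_ne_top hκ L _ (hupdate i)
    rw [partitionSum, partitionSum, ENNReal.toReal_add (partitionSum_ne_top hκ L _ hcons)
      (ENNReal.sum_ne_top.2 fun i _ => hne i), ENNReal.toReal_sum fun i _ => hne i, ih _ hcons]
    exact congrArg _ (Finset.sum_congr rfl fun i _ => ih _ (hupdate i))

instance countable_embedding {α β : Type*} [Finite α] [Countable β] : Countable (α ↪ β) :=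
  DFunLike.coe_injective.countable

theorem measurable_list_map_prod {Ω α M : Type*} [MeasurableSpace Ω] [MeasurableSpace M]
    [Monoid M] [MeasurableMul₂ M] {g : α → Ω → M} (hg : ∀ t, Measurable (g t)) (l : List α) :
    Measurable fun ω => (l.map fun t => g t ω).prod := by
  simpa [Function.comp_def] using List.measurable_fun_prod (l.map g) (by simp [hg])

theorem measurable_distinctSum {Ω ι : Type*} [MeasurableSpace Ω] [Countable ι] {k : ℕ}
    {a : Fin k → ι → Ω → ℝ≥0∞} (ha : ∀ i j, Measurable (a i j)) :
    Measurable fun ω => distinctSum fun i j => a i j ω :=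
  Measurable.tsum fun e => Finset.measurable_fun_prod _ fun i _ => ha i (e i)

theorem lintegral_prod_tsum_mul_distinctSum {Ω ι α : Type*} [MeasurableSpace Ω] {P : Measure Ω}
    [Countable ι] {f : α → ι → Ω → ℝ≥0∞} (hf : ∀ t j, Measurable (f t j)) {κ : List α → ℝ≥0∞}
    (hκ : ∀ {k : ℕ} (a : Fin k → List α),
      ∫⁻ ω, distinctSum (fun i j => ((a i).map fun t => f t j ω).prod) ∂P = ∏ i, κ (a i))
    (L : List α) {k : ℕ} (a : Fin k → List α) :
    ∫⁻ ω, (L.map fun t => ∑' j, f t j ω).prod *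
      distinctSum (fun i j => ((a i).map fun t => f t j ω).prod) ∂P = partitionSum κ L a := by
  have hmeas (L : List α) {k : ℕ} (a : Fin k → List α) : Measurable fun ω =>
      (L.map fun t => ∑' j, f t j ω).prod *
        distinctSum (fun i j => ((a i).map fun t => f t j ω).prod) :=
    (measurable_list_map_prod (fun t => .tsum (hf t)) L).mul
      (measurable_distinctSum fun i j => measurable_list_map_prod (fun t => hf t j) (a i))
  induction L generalizing k with
  | nil => simpa [partitionSum] using hκ a
  | cons t L ih =>
    rw [partitionSum, ← ih, ← Finset.sum_congr rfl fun i _ => ih (Function.update a i (t :: a i)),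
      ← lintegral_finsetSum _ fun i _ => hmeas L _, ← lintegral_add_left (hmeas L _)]
    refine lintegral_congr fun ω => ?_
    have hsplit := tsum_mul_distinctSum (fun j => f t j ω)
      fun i j => ((a i).map fun t => f t j ω).prod
    have hcons : (fun (i : Fin (k + 1)) j =>
        (((Fin.cons [t] a : Fin (k + 1) → List α) i).map fun t => f t j ω).prod) =
        Fin.cons (fun j => f t j ω) fun i j => ((a i).map fun t => f t j ω).prod := by
      ext i j; cases i using Fin.cases <;> simp
    have hupdate (i : Fin k) : (fun l j =>
        ((Function.update a i (t :: a i) l).map fun t => f t j ω).prod) =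
        Function.update (fun i j => ((a i).map fun t => f t j ω).prod) i
          ((fun j => f t j ω) * fun j => ((a i).map fun t => f t j ω).prod) := by
      ext l j; rcases eq_or_ne l i with rfl | hl <;> simp [*]
    simp_rw [hcons, hupdate, ← Finset.mul_sum]
    rw [← mul_add, ← hsplit, List.map_cons, List.prod_cons]
    ring

end DistinctSums

section ProductMeasures

theorem lintegral_pi_prod_eq_prod {α : Type*} [MeasurableSpace α] {k : ℕ} (μ : Fin k → Measure α)
    [∀ i, SigmaFinite (μ i)] {f : Fin k → α → ℝ≥0∞} (hf : ∀ i, Measurable (f i)) :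
    ∫⁻ x, ∏ i, f i (x i) ∂Measure.pi μ = ∏ i, ∫⁻ x, f i x ∂μ i := by
  induction k with
  | zero => simp
  | succ k ih =>
    rw [Fin.prod_univ_succ, ← ih (fun i => μ i.succ) (f := fun i => f i.succ) fun i => hf _,
      ← ((measurePreserving_piFinSuccAbove μ 0).symm).lintegral_comp_emb
        (MeasurableEquiv.measurableEmbedding _),
      ← lintegral_prod_mul (hf 0).aemeasurable
        (Finset.measurable_fun_prod _ fun i _ =>
          (hf i.succ).comp (measurable_pi_apply i)).aemeasurable]
    refine lintegral_congr fun x => ?_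
    rw [Fin.prod_univ_succ]
    simp [MeasurableEquiv.piFinSuccAbove]

variable {ι E : Type*} [Fintype ι] [MeasurableSpace E]

theorem pi_setOf_apply_eq_apply [MeasurableEq E] (μ : ι → Measure E) [∀ i, SigmaFinite (μ i)]
    {a b : ι} [NullSingletonClass (μ a)] (hab : a ≠ b) : Measure.pi μ {x | x a = x b} = 0 := by
  classical
  have hdiag : MeasurableSet {x : ι → E | x a = x b} :=
    measurableSet_eq_fun (measurable_pi_apply a) (measurable_pi_apply b)
  have hinner : ∫⋯∫⁻_{a}, {x | x a = x b}.indicator 1 ∂μ = ∫⋯∫⁻_{a}, 0 ∂μ := by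
    ext x
    rw [lmarginal_singleton, lmarginal_singleton]
    refine lintegral_congr_ae ?_
    filter_upwards [measure_eq_zero_iff_ae_notMem.1 (measure_singleton (μ := μ a) (x b))] with y hy
    exact Set.indicator_of_notMem (by simpa [hab.symm] using hy) _
  rw [← lintegral_indicator_one hdiag,
    lintegral_eq_of_lmarginal_eq {a} (measurable_one.indicator hdiag) measurable_zero hinner]
  exact lintegral_zero

variable [TopologicalSpace E] [T2Space E]

omit [Fintype ι] in
theorem exists_disjoint_open_of_injective [Finite ι] (μ : Measure E) [IsLocallyFiniteMeasure μ]
    {x : ι → E} (hx : Function.Injective x) :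
    ∃ A : ι → Set E, (∀ i, x i ∈ A i ∧ IsOpen (A i) ∧ μ (A i) ≠ ∞) ∧
      Pairwise fun i j => Disjoint (A i) (A j) := by
  obtain ⟨V, hV, hVd⟩ := (Set.finite_range x).t2_separation
  choose W hxW hW hμW using μ.exists_isOpen_measure_lt_top
  refine ⟨fun i => V (x i) ∩ W (x i), fun i => ⟨⟨(hV _).1, hxW _⟩, (hV _).2.inter (hW _),
    measure_ne_top_of_subset Set.inter_subset_right (hμW _).ne⟩, fun i j hij => ?_⟩
  exact (hVd (Set.mem_range_self i) (Set.mem_range_self j) (hx.ne hij)).mono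
    Set.inter_subset_left Set.inter_subset_left

theorem compl_setOf_injective {α β : Type*} :
    {x : α → β | Function.Injective x}ᶜ =
      ⋃ p : {p : α × α // p.1 ≠ p.2}, {x | x p.1.1 = x p.1.2} := by
  ext x
  simp [Function.Injective, and_comm]

theorem eq_pi_of_disjoint_rectangles [SecondCountableTopology E] [BorelSpace E]
    {μ : Measure E} [IsLocallyFiniteMeasure μ] [NullSingletonClass μ]
    {ν : Measure (ι → E)}
    (hrect : ∀ A : ι → Set E, (∀ i, MeasurableSet (A i)) → (∀ i, μ (A i) ≠ ∞) →
      (Pairwise fun i j => Disjoint (A i) (A j)) → ν (Set.univ.pi A) = ∏ i, μ (A i))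
    (hdiag : ∀ a b, a ≠ b → ν {x | x a = x b} = 0) : ν = Measure.pi fun _ => μ := by
  choose! A hA hAd using fun x : ι → E => exists_disjoint_open_of_injective μ (x := x)
  obtain ⟨t, ht, htc, hcov⟩ := TopologicalSpace.countable_cover_nhdsWithin
    (s := {x : ι → E | Function.Injective x}) (f := fun x => Set.univ.pi (A x)) fun x hx =>
      mem_nhdsWithin_of_mem_nhds <| (isOpen_set_pi Set.finite_univ
        fun i _ => (hA x hx i).2.1).mem_nhds fun i _ => (hA x hx i).1
  have hAm : ∀ x ∈ t, ∀ i, MeasurableSet (A x i) := fun x hx i => (hA x (ht hx) i).2.1.measurableSet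
  have hnull {ν' : Measure (ι → E)} (h : ∀ a b, a ≠ b → ν' {x | x a = x b} = 0) :
      ν'.restrict (⋃ x ∈ t, Set.univ.pi (A x)) = ν' := by
    rw [Measure.restrict_eq_self_of_ae_mem]
    refine measure_mono_null (Set.compl_subset_compl.2 hcov) ?_
    rw [compl_setOf_injective]
    exact measure_iUnion_null fun p => h _ _ p.2
  rw [← hnull hdiag, ← hnull fun a b => pi_setOf_apply_eq_apply (fun _ => μ),
    Measure.restrict_biUnion_congr htc]
  intro x hx
  rw [Measure.restrict_pi_pi]
  refine (Measure.pi_eq fun s hs => ?_).symm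
  rw [Measure.restrict_apply (MeasurableSet.univ_pi hs), ← Set.pi_inter_distrib,
    hrect _ fun i => (hs i).inter (hAm x hx i)]
  · exact Finset.prod_congr rfl fun i _ => (Measure.restrict_apply (hs i)).symm
  · exact fun i => measure_ne_top_of_subset Set.inter_subset_right (hA x (ht hx) i).2.2
  · exact fun i j hij => (hAd x (ht hx) hij).mono Set.inter_subset_right Set.inter_subset_right

end ProductMeasures

section Differentiation

variable {E : Type*} [MetricSpace E] [MeasurableSpace E] [BorelSpace E]
  {μ ν : Measure E} [IsLocallyFiniteMeasure μ] [NullSingletonClass μ]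

theorem tendsto_measure_closedBall_zero (x : E) :
    Filter.Tendsto (fun r => μ (Metric.closedBall x r)) (nhdsWithin 0 (Set.Ioi 0)) (nhds 0) := by
  obtain ⟨s, hs, hμs⟩ := μ.finiteAt_nhds x
  obtain ⟨ε, hε, hεs⟩ := Metric.nhds_basis_closedBall.mem_iff.1 hs
  have hlim := tendsto_measure_cthickening_of_isClosed (μ := μ) (s := {x})
    ⟨ε, hε, by
      rw [Metric.cthickening_singleton x hε.le]
      exact measure_ne_top_of_subset hεs hμs.ne⟩ isClosed_singleton
  rw [measure_singleton] at hlim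
  refine (hlim.mono_left nhdsWithin_le_nhds).congr' ?_
  filter_upwards [self_mem_nhdsWithin] with r hr
  rw [Metric.cthickening_singleton x (le_of_lt hr)]

theorem eq_zero_of_le_mul_sq [SecondCountableTopology E] [HasBesicovitchCovering E]
    [IsLocallyFiniteMeasure ν] {C : ℝ≥0∞} (hC : C ≠ ∞)
    (h : ∀ A, MeasurableSet A → μ A ≠ ∞ → ν A ≤ C * μ A ^ 2) : ν = 0 := by
  have hac : ν ≪ μ := Measure.AbsolutelyContinuous.mk fun A hA h0 => by
    simpa [h0] using h A hA (by simp [h0])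
  have hd : ν.rnDeriv μ =ᵐ[μ] 0 := by
    filter_upwards [Besicovitch.ae_tendsto_rnDeriv ν μ] with x hx
    have hball := tendsto_measure_closedBall_zero (μ := μ) x
    have hlim : Filter.Tendsto (fun r => C * μ (Metric.closedBall x r))
        (nhdsWithin 0 (Set.Ioi 0)) (nhds 0) := by
      simpa using ENNReal.Tendsto.const_mul hball (Or.inr hC)
    refine tendsto_nhds_unique hx (tendsto_of_tendsto_of_tendsto_of_le_of_le'
      tendsto_const_nhds hlim (.of_forall fun _ => zero_le) ?_)
    filter_upwards [hball.eventually_ne ENNReal.zero_ne_top] with r hr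
    refine ENNReal.div_le_of_le_mul ((h _ measurableSet_closedBall hr).trans_eq ?_)
    ring
  rw [← Measure.withDensity_rnDeriv_eq ν μ hac, withDensity_congr_ae hd, withDensity_zero]

end Differentiation

section FactorialMeasures

variable {Ω E F ι : Type*} [MeasurableSpace Ω] [MeasurableSpace E] [MeasurableSpace F]
  {P : Measure Ω} {k : ℕ}

/-- The `k`-th factorial moment measure of the point process `∑ⱼ ε_{ξⱼ}`: the expected number of
`k`-tuples of points with pairwise distinct indices in a subset of `Eᵏ`. -/
noncomputable def factorialMeasure (P : Measure Ω) (ξ : ι → Ω → E) (k : ℕ) :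
    Measure (Fin k → E) :=
  Measure.sum fun e : Fin k ↪ ι => P.map fun ω i => ξ (e i) ω

theorem lintegral_factorialMeasure [Countable ι] {ξ : ι → Ω → E} (hξ : ∀ j, Measurable (ξ j))
    {g : Fin k → E → ℝ≥0∞} (hg : ∀ i, Measurable (g i)) :
    ∫⁻ x, ∏ i, g i (x i) ∂factorialMeasure P ξ k =
      ∫⁻ ω, distinctSum (fun i j => g i (ξ j ω)) ∂P := by
  simp_rw [factorialMeasure, lintegral_sum_measure, distinctSum]
  rw [lintegral_tsum fun e => (Finset.measurable_fun_prod _ fun i _ =>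
    show Measurable fun ω => g i (ξ (e i) ω) from (hg i).comp (hξ (e i))).aemeasurable]
  exact tsum_congr fun e => lintegral_map (Finset.measurable_fun_prod _ fun i _ =>
    (hg i).comp (measurable_pi_apply i)) (measurable_pi_lambda _ fun i => hξ (e i))

theorem lintegral_distinctSum_of_factorialMeasure_eq_pi [Countable ι] {ξ : ι → Ω → E}
    (hξ : ∀ j, Measurable (ξ j)) {μ : Measure E} [SigmaFinite μ]
    (h : factorialMeasure P ξ k = Measure.pi fun _ => μ) {g : Fin k → E → ℝ≥0∞}
    (hg : ∀ i, Measurable (g i)) :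
    ∫⁻ ω, distinctSum (fun i j => g i (ξ j ω)) ∂P = ∏ i, ∫⁻ x, g i x ∂μ := by
  rw [← lintegral_factorialMeasure hξ hg, h, lintegral_pi_prod_eq_prod _ hg]

theorem factorialMeasure_setOf_apply_eq_apply [MeasurableEq E] {ξ : ι → Ω → E}
    (hξ : ∀ j, Measurable (ξ j)) (hsimple : ∀ i j, i ≠ j → P {ω | ξ i ω = ξ j ω} = 0)
    {a b : Fin k} (hab : a ≠ b) : factorialMeasure P ξ k {x | x a = x b} = 0 := by
  have hdiag : MeasurableSet {x : Fin k → E | x a = x b} :=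
    measurableSet_eq_fun (measurable_pi_apply a) (measurable_pi_apply b)
  rw [factorialMeasure, Measure.sum_apply _ hdiag, ENNReal.tsum_eq_zero]
  intro e
  rw [Measure.map_apply (measurable_pi_lambda _ fun i => hξ (e i)) hdiag]
  exact hsimple _ _ (e.injective.ne hab)

theorem map_embedding_marked [IsProbabilityMeasure P] {ξ : ι → Ω → E} {η : ι → Ω → F}
    {Q : Measure F} (hξ : ∀ j, Measurable (ξ j)) (hη : ∀ j, Measurable (η j))
    (hlaw : ∀ j, P.map (η j) = Q) (hindep : iIndepFun η P)
    (hξη : IndepFun (fun ω j => ξ j ω) (fun ω j => η j ω) P) (e : Fin k ↪ ι) :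
    P.map (fun ω => (fun i => ξ (e i) ω, fun i => η (e i) ω)) =
      (P.map fun ω i => ξ (e i) ω).prod (Measure.pi fun _ => Q) := by
  have hξηe : IndepFun (fun ω i => ξ (e i) ω) (fun ω i => η (e i) ω) P :=
    hξη.comp (φ := fun x i => x (e i)) (ψ := fun y i => y (e i))
      (measurable_pi_lambda _ fun i => measurable_pi_apply _)
      (measurable_pi_lambda _ fun i => measurable_pi_apply _)
  rw [(indepFun_iff_map_prod_eq_prod_map_map
      (measurable_pi_lambda _ fun i => hξ (e i)).aemeasurable
      (measurable_pi_lambda _ fun i => hη (e i)).aemeasurable).1 hξηe,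
    (iIndepFun_iff_map_fun_eq_pi_map fun i => (hη (e i)).aemeasurable).1
      (hindep.precomp e.injective)]
  simp_rw [hlaw]

theorem factorialMeasure_marked [IsProbabilityMeasure P] {ξ : ι → Ω → E} {η : ι → Ω → F}
    {Q : Measure F} [SigmaFinite Q] {μ : Measure E} [SigmaFinite μ]
    (hξ : ∀ j, Measurable (ξ j)) (hη : ∀ j, Measurable (η j))
    (hlaw : ∀ j, P.map (η j) = Q) (hindep : iIndepFun η P)
    (hξη : IndepFun (fun ω j => ξ j ω) (fun ω j => η j ω) P)
    (h : factorialMeasure P ξ k = Measure.pi fun _ => μ) :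
    factorialMeasure P (fun j ω => (ξ j ω, η j ω)) k = Measure.pi fun _ => μ.prod Q := by
  set Φ := MeasurableEquiv.arrowProdEquivProdArrow E F (Fin k)
  refine Φ.map_measurableEquiv_injective ?_
  calc (factorialMeasure P (fun j ω => (ξ j ω, η j ω)) k).map Φ
      = Measure.sum fun e : Fin k ↪ ι =>
          P.map fun ω => (fun i => ξ (e i) ω, fun i => η (e i) ω) := by
        rw [factorialMeasure, Measure.map_sum Φ.measurable.aemeasurable]
        congr 1 with e : 1
        exact Measure.map_map Φ.measurable
          (measurable_pi_lambda _ fun i => (hξ (e i)).prodMk (hη (e i)))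
    _ = (factorialMeasure P ξ k).prod (Measure.pi fun _ => Q) := by
        simp_rw [map_embedding_marked hξ hη hlaw hindep hξη, factorialMeasure,
          Measure.prod_sum_left]
    _ = (Measure.pi fun _ => μ.prod Q).map Φ := by
        rw [h, (measurePreserving_arrowProdEquivProdArrow E F (Fin k) (fun _ => μ)
          fun _ => Q).map_eq]

end FactorialMeasures

section PoissonProcess

theorem lintegral_natCast_poissonMeasure (r : ℝ≥0) :
    ∫⁻ n : ℕ, (n : ℝ≥0∞) ∂poissonMeasure r = r := by
  rw [lintegral_countable']
  simp_rw [poissonMeasure_singleton]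
  rw [tsum_eq_zero_add' ENNReal.summable]
  have hshift : ∀ n : ℕ, ((n + 1 : ℕ) : ℝ≥0∞) *
      ENNReal.ofReal (Real.exp (-r) * r ^ (n + 1) / (n + 1).factorial) =
      r * poissonMeasure r {n} := by
    intro n
    rw [poissonMeasure_singleton, ← ENNReal.ofReal_natCast, ← ENNReal.ofReal_coe_nnreal,
      ← ENNReal.ofReal_mul (by positivity), ← ENNReal.ofReal_mul (by positivity)]
    congr 1
    rw [Nat.factorial_succ]
    push_cast
    field_simp
    ring
  simp_rw [hshift, ENNReal.tsum_mul_left]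
  have htotal := lintegral_countable' (μ := poissonMeasure r) (fun _ : ℕ => (1 : ℝ≥0∞))
  simp only [one_mul, lintegral_const, measure_univ] at htotal
  simp [← htotal]

theorem poissonMeasure_Ici_two_le (r : ℝ≥0) : poissonMeasure r (Set.Ici 2) ≤ r ^ 2 := by
  have hcompl : (Set.Ici 2 : Set ℕ) = {0, 1}ᶜ := by
    ext n
    simp only [Set.mem_Ici, Set.mem_compl_iff, Set.mem_insert_iff, Set.mem_singleton_iff]
    omega
  have hreal : (poissonMeasure r).real (Set.Ici 2) ≤ (r : ℝ) ^ 2 := by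
    rw [hcompl, probReal_compl_eq_one_sub (by measurability), Set.insert_eq,
      measureReal_union (by simp) (by measurability), poissonMeasure_real_singleton,
      poissonMeasure_real_singleton]
    have hexp := Real.add_one_le_exp (-(r : ℝ))
    simp only [pow_zero, Nat.factorial_zero, Nat.factorial_one, pow_one]
    push_cast
    nlinarith [r.2, NNReal.coe_nonneg r]
  rw [← ENNReal.ofReal_coe_nnreal, ← ENNReal.ofReal_pow (NNReal.coe_nonneg r)]
  exact (ENNReal.le_ofReal_iff_toReal_le (measure_ne_top _ _) (by positivity)).2 hreal

variable {d : ℕ} {Ω : Type*}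

theorem pointProcess_apply (ξ : ℤ → Ω → EuclideanSpace ℝ (Fin d)) (ω : Ω)
    {A : Set (EuclideanSpace ℝ (Fin d))} (hA : MeasurableSet A) :
    pointProcess ξ ω A = ∑' j, A.indicator 1 (ξ j ω) := by
  rw [pointProcess, Measure.sum_apply _ hA]
  exact tsum_congr fun j => Measure.dirac_apply' _ hA

variable [MeasurableSpace Ω] {P : Measure Ω} {lam : ℝ≥0} {ξ : ℤ → Ω → EuclideanSpace ℝ (Fin d)}

namespace IsHomogeneousPoisson

theorem measurable_apply (h : IsHomogeneousPoisson P lam ξ)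
    {A : Set (EuclideanSpace ℝ (Fin d))} (hA : MeasurableSet A) :
    Measurable fun ω => pointProcess ξ ω A := by
  simp_rw [pointProcess_apply ξ _ hA]
  exact Measurable.tsum fun j => (measurable_one.indicator hA).comp (h.measurable j)

theorem lintegral_apply_of_ne_top (h : IsHomogeneousPoisson P lam ξ)
    {A : Set (EuclideanSpace ℝ (Fin d))} (hA : MeasurableSet A) (hA' : volume A ≠ ∞) :
    ∫⁻ ω, pointProcess ξ ω A ∂P = lam * volume A := by
  have hlaw := h.hasLaw A hA hA'
  rw [← lintegral_map' (f := fun x => x) aemeasurable_id hlaw.aemeasurable, hlaw.map_eq,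
    lintegral_map (f := fun x => x) measurable_id (by fun_prop), lintegral_natCast_poissonMeasure]
  simp [ENNReal.coe_toNNReal hA']

theorem sum_map_eq_smul_volume (h : IsHomogeneousPoisson P lam ξ) :
    Measure.sum (fun j => P.map (ξ j)) = lam • volume := by
  have hfin {A : Set (EuclideanSpace ℝ (Fin d))} (hA : MeasurableSet A) (hA' : volume A ≠ ∞) :
      Measure.sum (fun j => P.map (ξ j)) A = lam * volume A := by
    rw [← h.lintegral_apply_of_ne_top hA hA', Measure.sum_apply _ hA]
    simp_rw [pointProcess_apply ξ _ hA]
    rw [lintegral_tsum fun j => show AEMeasurable (fun ω => A.indicator 1 (ξ j ω)) P from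
      ((measurable_one.indicator hA).comp (h.measurable j)).aemeasurable]
    refine tsum_congr fun j => ?_
    rw [Measure.map_apply (h.measurable j) hA, ← lintegral_indicator_one (h.measurable j hA)]
    rfl
  refine (Measure.ext_iff_of_iUnion_eq_univ (iUnion_spanningSets volume)).2 fun n => ?_
  ext A hA
  rw [Measure.restrict_apply hA, Measure.restrict_apply hA,
    hfin (hA.inter (measurableSet_spanningSets _ _))
      (measure_ne_top_of_subset Set.inter_subset_right (measure_spanningSets_lt_top _ _).ne)]
  rfl

variable [IsProbabilityMeasure P]

theorem rate_mul_volume_univ (h : IsHomogeneousPoisson P lam ξ) :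
    lam * volume (Set.univ : Set (EuclideanSpace ℝ (Fin d))) = ∞ := by
  have huniv := congrArg (fun μ => μ Set.univ) h.sum_map_eq_smul_volume
  have hone (j : ℤ) : P.map (ξ j) Set.univ = 1 := by
    rw [Measure.map_apply (h.measurable j) MeasurableSet.univ, Set.preimage_univ, measure_univ]
  simp only [Measure.sum_apply _ MeasurableSet.univ, hone, ENNReal.tsum_const,
    ENat.card_eq_top_of_infinite, ENat.toENNReal_top, mul_one] at huniv
  exact huniv.symm

theorem rate_pos (h : IsHomogeneousPoisson P lam ξ) : 0 < lam := by
  refine pos_iff_ne_zero.2 fun hlam => ?_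
  simpa [hlam] using h.rate_mul_volume_univ

theorem dim_pos (h : IsHomogeneousPoisson P lam ξ) : 0 < d := by
  refine Nat.pos_of_ne_zero fun hd => ?_
  subst hd
  exact ENNReal.mul_ne_top ENNReal.coe_ne_top
    (Set.toFinite Set.univ).isCompact.measure_ne_top h.rate_mul_volume_univ

omit [IsProbabilityMeasure P] in
theorem measure_two_le_apply (h : IsHomogeneousPoisson P lam ξ)
    {A : Set (EuclideanSpace ℝ (Fin d))} (hA : MeasurableSet A) (hA' : volume A ≠ ∞) :
    P {ω | 2 ≤ pointProcess ξ ω A} ≤ (lam * volume A) ^ 2 := by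
  have hlaw := h.hasLaw A hA hA'
  have hI : MeasurableSet {x : ℝ≥0∞ | 2 ≤ x} := measurableSet_Ici
  rw [hlaw.measure_eq hI, Measure.map_apply (by fun_prop) hI]
  convert poissonMeasure_Ici_two_le (lam * (volume A).toNNReal) using 2
  · ext n
    simp only [Set.mem_preimage, Set.mem_ofPred_eq, Set.mem_Ici]
    exact_mod_cast Iff.rfl
  · simp [ENNReal.coe_toNNReal hA']

theorem measure_setOf_eq (h : IsHomogeneousPoisson P lam ξ) {i j : ℤ} (hij : i ≠ j) :
    P {ω | ξ i ω = ξ j ω} = 0 := by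
  have : Nonempty (Fin d) := ⟨⟨0, h.dim_pos⟩⟩
  suffices hν : (P.restrict {ω | ξ i ω = ξ j ω}).map (ξ i) = 0 by
    rwa [Measure.map_eq_zero_iff (h.measurable i).aemeasurable, Measure.restrict_eq_zero] at hν
  refine eq_zero_of_le_mul_sq (μ := volume) (C := (lam : ℝ≥0∞) ^ 2) (by finiteness)
    fun A hA hA' => ?_
  rw [← mul_pow, Measure.map_apply (h.measurable i) hA, Measure.restrict_apply (h.measurable i hA)]
  refine (measure_mono fun ω hω => ?_).trans (h.measure_two_le_apply hA hA')
  simp only [Set.mem_inter_iff, Set.mem_preimage, Set.mem_ofPred_eq] at hω ⊢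
  rw [pointProcess_apply ξ _ hA]
  refine le_trans ?_ (ENNReal.sum_le_tsum {i, j})
  rw [Finset.sum_pair hij, ← hω.2, Set.indicator_of_mem hω.1]
  simp [one_add_one_eq_two]

omit [IsProbabilityMeasure P] in
theorem factorialMeasure_pi (h : IsHomogeneousPoisson P lam ξ) {k : ℕ}
    {A : Fin k → Set (EuclideanSpace ℝ (Fin d))} (hA : ∀ i, MeasurableSet (A i))
    (hA' : ∀ i, volume (A i) ≠ ∞) (hd : Pairwise fun i j => Disjoint (A i) (A j)) :
    factorialMeasure P ξ k (Set.univ.pi A) = ∏ i, (lam • volume) (A i) := by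
  have hcount (ω : Ω) : distinctSum (fun i j =>
      (A i).indicator (1 : EuclideanSpace ℝ (Fin d) → ℝ≥0∞) (ξ j ω)) =
      ∏ i, pointProcess ξ ω (A i) := by
    rw [distinctSum_eq_prod]
    · simp_rw [pointProcess_apply ξ ω (hA _)]
    · intro i l hil
      ext j
      simp only [Pi.mul_apply, Pi.zero_apply, mul_eq_zero, Set.indicator_apply_eq_zero]
      by_contra! hc
      exact Set.disjoint_left.1 (hd hil) hc.1.1 hc.2.1
  rw [← lintegral_indicator_one (MeasurableSet.univ_pi hA), ← Finset.coe_univ]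
  simp_rw [Set.indicator_pi_one_apply]
  rw [lintegral_factorialMeasure h.measurable fun i => measurable_one.indicator (hA i)]
  simp_rw [hcount]
  rw [lintegral_prod_eq_prod_lintegral_of_indepFun _ _ (h.indep k A hA hA' hd)
    fun i => h.measurable_apply (hA i)]
  exact Finset.prod_congr rfl fun i _ => h.lintegral_apply_of_ne_top (hA i) (hA' i)

theorem factorialMeasure_eq_pi (h : IsHomogeneousPoisson P lam ξ) (k : ℕ) :
    factorialMeasure P ξ k = Measure.pi fun _ => lam • volume := by
  have : Nonempty (Fin d) := ⟨⟨0, h.dim_pos⟩⟩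
  have : NullSingletonClass (lam • (volume : Measure (EuclideanSpace ℝ (Fin d)))) :=
    ⟨fun x => by simp⟩
  refine eq_pi_of_disjoint_rectangles (fun A hA hA' hd => h.factorialMeasure_pi hA
    (fun i hi => hA' i ?_) hd)
    fun a b hab => factorialMeasure_setOf_apply_eq_apply h.measurable
      (fun i j hij => h.measure_setOf_eq hij) hab
  rw [Measure.smul_apply, ENNReal.smul_def, smul_eq_mul, hi,
    ENNReal.mul_top (by simpa using h.rate_pos.ne')]

end IsHomogeneousPoisson

end PoissonProcess

section Overlaps

variable {d : ℕ} {Ω' : Type*} [MeasurableSpace Ω'] {P' : Measure Ω'} {lam : ℝ≥0}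
  {B : Set (EuclideanSpace ℝ (Fin d))} {Y : ℝ≥0 → Ω' → EuclideanSpace ℝ (Fin d)} {k : ℕ}

theorem mem_shift_iff {x y : EuclideanSpace ℝ (Fin d)} : y ∈ shift B x ↔ y + x ∈ B :=
  ⟨fun ⟨z, hz, h⟩ => by simpa [h] using hz, fun h => ⟨_, h, by simp⟩⟩

theorem shift_eq_preimage (B : Set (EuclideanSpace ℝ (Fin d))) (x : EuclideanSpace ℝ (Fin d)) :
    shift B x = (· + x) ⁻¹' B :=
  Set.ext fun _ => mem_shift_iff

theorem measurableSet_shift (hB : MeasurableSet B) (x : EuclideanSpace ℝ (Fin d)) :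
    MeasurableSet (shift B x) :=
  shift_eq_preimage B x ▸ measurable_add_const x hB

theorem volume_shift (B : Set (EuclideanSpace ℝ (Fin d))) (x : EuclideanSpace ℝ (Fin d)) :
    volume (shift B x) = volume B := by
  rw [shift_eq_preimage, measure_preimage_add_right]

theorem measurable_volume_iInter_shift (hB : MeasurableSet B) (hY : ∀ t, Measurable (Y t))
    (t : Fin k → ℝ≥0) : Measurable fun ω => volume (⋂ i, shift B (Y (t i) ω)) := by
  have hmem : MeasurableSet
      {p : EuclideanSpace ℝ (Fin d) × Ω' | ∀ i, p.1 + Y (t i) p.2 ∈ B} := by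
    rw [Set.ofPred_forall]
    exact MeasurableSet.iInter fun i =>
      (measurable_fst.add ((hY (t i)).comp measurable_snd)) hB
  simpa only [Set.preimage_ofPred_eq, ← mem_shift_iff, ← Set.mem_iInter, Set.ofPred_mem_eq]
    using measurable_measure_prodMk_right (μ := volume) hmem

/-- The expected volume `E vol(B(Y_{t₁}) ∩ … ∩ B(Y_{tₖ}))`: the extended real valued, unnormalised
version of `U`. -/
noncomputable def overlap (P' : Measure Ω') (B : Set (EuclideanSpace ℝ (Fin d)))
    (Y : ℝ≥0 → Ω' → EuclideanSpace ℝ (Fin d)) (t : Fin k → ℝ≥0) : ℝ≥0∞ :=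
  ∫⁻ ω, volume (⋂ i, shift B (Y (t i) ω)) ∂P'

theorem overlap_le_overlap_comp {l : ℕ} (t : Fin k → ℝ≥0) (φ : Fin l → Fin k) :
    overlap P' B Y t ≤ overlap P' B Y (t ∘ φ) :=
  lintegral_mono fun _ => measure_mono fun _ hx =>
    Set.mem_iInter.2 fun i => Set.mem_iInter.1 hx (φ i)

theorem rho_nonneg : 0 ≤ rho lam B :=
  mul_nonneg lam.2 measureReal_nonneg

theorem U_nonneg (t : Fin k → ℝ≥0) : 0 ≤ U P' B Y t :=
  mul_nonneg (by positivity) (integral_nonneg fun _ => measureReal_nonneg)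

variable [IsProbabilityMeasure P']

theorem overlap_const [NeZero k] (s : ℝ≥0) :
    overlap P' B Y (fun _ : Fin k => s) = volume B := by
  simp [overlap, Set.iInter_const, volume_shift]

theorem overlap_ne_top (hB' : volume B ≠ ∞) [NeZero k] (t : Fin k → ℝ≥0) :
    overlap P' B Y t ≠ ∞ := by
  refine ne_top_of_le_ne_top hB' ((overlap_le_overlap_comp t fun _ : Fin 1 => 0).trans_eq ?_)
  exact overlap_const (t 0)

theorem U_eq_overlap_toReal_div (hB : MeasurableSet B) (hB' : volume B ≠ ∞)
    (hY : ∀ t, Measurable (Y t)) (t : Fin k → ℝ≥0) :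
    U P' B Y t = (overlap P' B Y t).toReal / volume.real B := by
  rcases k.eq_zero_or_pos with rfl | hk
  · simp [U, overlap, Measure.real, div_eq_inv_mul]
  · have : NeZero k := ⟨hk.ne'⟩
    have hmeas := (measurable_volume_iInter_shift hB hY t).aemeasurable (μ := P')
    rw [U, overlap, ← integral_toReal hmeas (ae_lt_top' hmeas (overlap_ne_top hB' t))]
    simp only [Measure.real, div_eq_inv_mul, mul_one]

theorem toReal_mul_overlap (hB : MeasurableSet B) (hB' : volume B ≠ ∞) (hB0 : volume B ≠ 0)
    (hY : ∀ t, Measurable (Y t)) (t : Fin k → ℝ≥0) :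
    (lam * overlap P' B Y t).toReal = rho lam B * U P' B Y t := by
  have h0 : volume.real B ≠ 0 := (ENNReal.toReal_pos hB0 hB').ne'
  rw [U_eq_overlap_toReal_div hB hB' hY, rho, ENNReal.toReal_mul, ENNReal.coe_toReal]
  field_simp

theorem U_le_U_comp (hB : MeasurableSet B) (hB' : volume B ≠ ∞) (hY : ∀ t, Measurable (Y t))
    {l : ℕ} [NeZero l] (t : Fin k → ℝ≥0) (φ : Fin l → Fin k) :
    U P' B Y t ≤ U P' B Y (t ∘ φ) := by
  rw [U_eq_overlap_toReal_div hB hB' hY, U_eq_overlap_toReal_div hB hB' hY]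
  gcongr
  · exact overlap_ne_top hB' _
  · exact overlap_le_overlap_comp t φ

theorem U_const (hB' : volume B ≠ ∞) (hB0 : volume B ≠ 0) [NeZero k] (s : ℝ≥0) :
    U P' B Y (fun _ : Fin k => s) = 1 := by
  have h0 : volume.real B ≠ 0 := (ENNReal.toReal_pos hB0 hB').ne'
  simpa [U, Set.iInter_const, Measure.real, volume_shift] using inv_mul_cancel₀ h0

theorem U_le_one (hB : MeasurableSet B) (hB' : volume B ≠ ∞) (hB0 : volume B ≠ 0)
    (hY : ∀ t, Measurable (Y t)) [NeZero k] (t : Fin k → ℝ≥0) : U P' B Y t ≤ 1 :=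
  (U_le_U_comp hB hB' hY t (fun _ : Fin 1 => 0)).trans_eq (U_const hB' hB0 (t 0))

omit [IsProbabilityMeasure P'] in
theorem H_eq_U (hY0 : ∀ᵐ ω ∂P', Y 0 ω = 0) (x : ℝ) :
    H P' B Y x = U P' B Y ![0, Real.nnabs x] := by
  unfold H U
  congr 1
  refine integral_congr_ae ?_
  filter_upwards [hY0] with ω hω
  congr 1
  ext y
  simp [mem_shift_iff, Fin.forall_fin_two, hω]

omit [IsProbabilityMeasure P'] in
theorem H_neg (x : ℝ) : H P' B Y (-x) = H P' B Y x := by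
  have : Real.nnabs (-x) = Real.nnabs x := by ext; simp
  rw [H, H, this]

theorem H_mem_Icc (hB : MeasurableSet B) (hB' : volume B ≠ ∞) (hB0 : volume B ≠ 0)
    (hY : ∀ t, Measurable (Y t)) (hY0 : ∀ᵐ ω ∂P', Y 0 ω = 0) (x : ℝ) :
    H P' B Y x ∈ Set.Icc (0 : ℝ) 1 :=
  H_eq_U hY0 x ▸ ⟨U_nonneg _, U_le_one hB hB' hB0 hY _⟩

end Overlaps

section Hits

variable {d : ℕ} {B : Set (EuclideanSpace ℝ (Fin d))}

/-- The indicator that a particle which starts at `p.1` and has displacement path `p.2` is in `B`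
at time `t`. -/
noncomputable def hit (B : Set (EuclideanSpace ℝ (Fin d))) (t : ℝ≥0)
    (p : EuclideanSpace ℝ (Fin d) × (ℝ≥0 → EuclideanSpace ℝ (Fin d))) : ℝ≥0∞ :=
  B.indicator (fun _ => 1) (p.1 + p.2 t)

theorem measurable_hit (hB : MeasurableSet B) (t : ℝ≥0) : Measurable (hit B t) :=
  (measurable_const.indicator hB).comp
    (measurable_fst.add ((measurable_pi_apply t).comp measurable_snd))

theorem prod_hit_eq_indicator (B : Set (EuclideanSpace ℝ (Fin d))) {k : ℕ} (t : Fin k → ℝ≥0)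
    (x : EuclideanSpace ℝ (Fin d)) (y : ℝ≥0 → EuclideanSpace ℝ (Fin d)) :
    ∏ i, hit B (t i) (x, y) = (⋂ i, shift B (y (t i))).indicator 1 x := by
  by_cases hx : x ∈ ⋂ i, shift B (y (t i))
  · rw [Set.indicator_of_mem hx]
    exact Finset.prod_eq_one fun i _ =>
      Set.indicator_of_mem (mem_shift_iff.1 (Set.mem_iInter.1 hx i)) _
  · rw [Set.indicator_of_notMem hx]
    obtain ⟨i, hi⟩ := not_forall.1 (mt Set.mem_iInter.2 hx)
    exact Finset.prod_eq_zero (Finset.mem_univ i)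
      (Set.indicator_of_notMem (fun h => hi (mem_shift_iff.2 h)) _)

theorem lintegral_prod_hit {Ω' : Type*} [MeasurableSpace Ω'] {P' : Measure Ω'} [SFinite P']
    {Y : ℝ≥0 → Ω' → EuclideanSpace ℝ (Fin d)} (hY : ∀ t, Measurable (Y t)) (hB : MeasurableSet B)
    (lam : ℝ≥0) {k : ℕ} (t : Fin k → ℝ≥0) :
    ∫⁻ p, ∏ i, hit B (t i) p ∂((lam • volume).prod (P'.map fun ω t => Y t ω)) =
      lam * overlap P' B Y t := by
  have hhit : Measurable fun p => ∏ i, hit B (t i) p :=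
    Finset.measurable_fun_prod _ fun i _ => measurable_hit hB (t i)
  rw [lintegral_prod_symm' _ hhit,
    lintegral_map hhit.lintegral_prod_left' (measurable_pi_lambda _ hY), overlap,
    ← lintegral_const_mul' _ _ ENNReal.coe_ne_top]
  refine lintegral_congr fun ω => ?_
  simp_rw [prod_hit_eq_indicator]
  rw [lintegral_indicator_one (MeasurableSet.iInter fun i => measurableSet_shift hB _)]
  rfl

end Hits

section Integrals

variable {Ω : Type*} [MeasurableSpace Ω] {P : Measure Ω}

/-- `f` is integrable and its integral is `v`. Unlike `∫ ω, f ω ∂P = v`, this is additive in `f`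
without side conditions. -/
def HasIntegral (P : Measure Ω) (f : Ω → ℝ) (v : ℝ) : Prop :=
  Integrable f P ∧ ∫ ω, f ω ∂P = v

namespace HasIntegral

variable {f g : Ω → ℝ} {u v : ℝ}

theorem sub (hf : HasIntegral P f u) (hg : HasIntegral P g v) :
    HasIntegral P (fun ω => f ω - g ω) (u - v) :=
  ⟨hf.1.sub hg.1, by rw [integral_sub hf.1 hg.1, hf.2, hg.2]⟩

theorem const_mul (hf : HasIntegral P f u) (c : ℝ) : HasIntegral P (fun ω => c * f ω) (c * u) :=
  ⟨hf.1.const_mul c, by rw [integral_const_mul, hf.2]⟩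

theorem congr (hf : HasIntegral P f u) (hfg : ∀ ω, f ω = g ω) (huv : u = v) :
    HasIntegral P g v :=
  funext hfg ▸ huv ▸ hf

theorem toReal {f : Ω → ℝ≥0∞} {v : ℝ≥0∞} (hf : AEMeasurable f P) (h : ∫⁻ ω, f ω ∂P = v)
    (hv : v ≠ ∞) : HasIntegral P (fun ω => (f ω).toReal) v.toReal := by
  subst h
  exact ⟨integrable_toReal_of_lintegral_ne_top hf hv, integral_toReal hf (ae_lt_top' hf hv)⟩

end HasIntegral

/-- The expectation of `∏ t ∈ K, (X t - c) * ∏ t ∈ L, X t`, where `m L` is that of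
`∏ t ∈ L, X t`. -/
def centeredMoment {α : Type*} (m : List α → ℝ) (c : ℝ) : List α → List α → ℝ
  | [], L => m L
  | t :: K, L => centeredMoment m c K (t :: L) - c * centeredMoment m c K L

theorem hasIntegral_prod_sub_mul_prod {α : Type*} {X : α → Ω → ℝ} {m : List α → ℝ}
    (h : ∀ L, HasIntegral P (fun ω => (L.map fun t => X t ω).prod) (m L)) (c : ℝ)
    (K L : List α) :
    HasIntegral P (fun ω => (K.map fun t => X t ω - c).prod * (L.map fun t => X t ω).prod)
      (centeredMoment m c K L) := by
  induction K generalizing L with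
  | nil => simpa [centeredMoment] using h L
  | cons t K ih =>
    refine ((ih (t :: L)).sub ((ih L).const_mul c)).congr (fun ω => ?_) rfl
    simp only [List.map_cons, List.prod_cons]
    ring

theorem partitionSum_singleton {α : Type*} (κ : List α → ℝ) (t : α) :
    partitionSum κ [t] ![] = κ [t] := by
  simp [partitionSum]

theorem centeredMoment_partitionSum_pair {α : Type*} {κ : List α → ℝ} {c : ℝ}
    (hκ : ∀ t, κ [t] = c) (s t : α) :
    centeredMoment (fun L => partitionSum κ L ![]) c [s, t] [] = κ [s, t] := by
  simp [centeredMoment, partitionSum, Fin.prod_univ_succ, hκ]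

theorem centeredMoment_partitionSum_four {α : Type*} {κ : List α → ℝ} {c : ℝ}
    (hκ : ∀ t, κ [t] = c) (s t u v : α) :
    centeredMoment (fun L => partitionSum κ L ![]) c [s, t, u, v] [] =
      κ [s, t] * κ [u, v] + κ [s, u] * κ [t, v] + κ [s, v] * κ [t, u] + κ [s, t, u, v] := by
  simp [centeredMoment, partitionSum, Fin.prod_univ_succ, Fin.sum_univ_succ, hκ]
  ring

end Integrals

section Moments

variable {d : ℕ} {Ω Ω' : Type*} [MeasurableSpace Ω] [MeasurableSpace Ω'] {P : Measure Ω}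
  [IsProbabilityMeasure P] {P' : Measure Ω'} [IsProbabilityMeasure P'] {lam : ℝ≥0}
  {B : Set (EuclideanSpace ℝ (Fin d))} {Y : ℝ≥0 → Ω' → EuclideanSpace ℝ (Fin d)}
  {ξ : ℤ → Ω → EuclideanSpace ℝ (Fin d)} {Yp : ℤ → ℝ≥0 → Ω → EuclideanSpace ℝ (Fin d)}

omit [IsProbabilityMeasure P'] in
theorem U_get_pair (s t : ℝ≥0) : U P' B Y [s, t].get = U P' B Y ![s, t] :=
  congrArg (U P' B Y (k := 2)) (by ext i; fin_cases i <;> rfl)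

omit [IsProbabilityMeasure P'] in
theorem U_get_four (s t u v : ℝ≥0) : U P' B Y [s, t, u, v].get = U P' B Y ![s, t, u, v] :=
  congrArg (U P' B Y (k := 4)) (by ext i; fin_cases i <;> rfl)

theorem rho_mul_U_get_singleton (hB' : volume B ≠ ∞) (hB0 : volume B ≠ 0) (t : ℝ≥0) :
    rho lam B * U P' B Y [t].get = rho lam B := by
  have hU : U P' B Y [t].get = 1 :=
    (congrArg (U P' B Y (k := 1)) (by ext i; simp)).trans (U_const hB' hB0 t)
  rw [hU, mul_one]

theorem IsParticleSystem.lintegral_prod_count (h : IsParticleSystem P P' lam Y ξ Yp)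
    (hB : MeasurableSet B) (L : List ℝ≥0) :
    ∫⁻ ω, (L.map fun t => ∑' j, hit B t (ξ j ω, fun t => Yp j t ω)).prod ∂P =
      partitionSum (fun l => lam * overlap P' B Y l.get) L ![] := by
  have hpath (j : ℤ) : Measurable fun ω t => Yp j t ω :=
    measurable_pi_lambda _ (h.measurable_copy j)
  have hparticle (j : ℤ) : Measurable fun ω => (ξ j ω, fun t => Yp j t ω) :=
    (h.poisson.measurable j).prodMk (hpath j)
  have hmarked (k : ℕ) := factorialMeasure_marked h.poisson.measurable hpath
    (fun j => (h.identDistrib j).map_eq) h.iIndep_copies h.indep_initial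
    (h.poisson.factorialMeasure_eq_pi k)
  have hκ {k : ℕ} (a : Fin k → List ℝ≥0) :
      ∫⁻ ω, distinctSum (fun i j =>
        ((a i).map fun t => hit B t (ξ j ω, fun t => Yp j t ω)).prod) ∂P =
        ∏ i, lam * overlap P' B Y (a i).get := by
    refine (lintegral_distinctSum_of_factorialMeasure_eq_pi hparticle (hmarked k)
      fun i => measurable_list_map_prod (measurable_hit hB) (a i)).trans ?_
    refine Finset.prod_congr rfl fun i _ => ?_
    rw [← lintegral_prod_hit h.measurable_generic hB]
    refine lintegral_congr fun p => ?_
    rw [← List.prod_ofFn]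
    exact congrArg _ (List.ofFn_getElem_eq_map (a i) fun t => hit B t p).symm
  simpa using lintegral_prod_tsum_mul_distinctSum
    (fun t j => (measurable_hit hB t).comp (hparticle j)) hκ L ![]

theorem IsParticleSystem.hasIntegral_prod_N (h : IsParticleSystem P P' lam Y ξ Yp)
    (hB : MeasurableSet B) (hB' : volume B ≠ ∞) (hB0 : volume B ≠ 0) (L : List ℝ≥0) :
    HasIntegral P (fun ω => (L.map fun t => N B ξ Yp t ω).prod)
      (partitionSum (fun l => rho lam B * U P' B Y l.get) L ![]) := by
  have hmeas (t : ℝ≥0) : Measurable fun ω => ∑' j, hit B t (ξ j ω, fun t => Yp j t ω) :=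
    .tsum fun j => (measurable_hit hB t).comp
      ((h.poisson.measurable j).prodMk (measurable_pi_lambda _ (h.measurable_copy j)))
  have hκ (t : ℝ≥0) (l : List ℝ≥0) : lam * overlap P' B Y (t :: l).get ≠ ∞ :=
    ENNReal.mul_ne_top ENNReal.coe_ne_top (overlap_ne_top (k := l.length + 1) hB' _)
  refine (HasIntegral.toReal (measurable_list_map_prod hmeas L).aemeasurable
    (h.lintegral_prod_count hB L) (partitionSum_ne_top hκ L _ finZeroElim)).congr (fun ω => ?_) ?_
  · exact (map_list_prod ENNReal.toRealHom _).trans (by rw [List.map_map]; rfl)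
  · rw [toReal_partitionSum hκ L _ finZeroElim]
    simp_rw [toReal_mul_overlap hB hB' hB0 h.measurable_generic]

theorem IsParticleSystem.hasIntegral_prod_centered (h : IsParticleSystem P P' lam Y ξ Yp)
    (hB : MeasurableSet B) (hB' : volume B ≠ ∞) (hB0 : volume B ≠ 0) (L : List ℝ≥0) :
    HasIntegral P (fun ω => (L.map fun t => N B ξ Yp t ω - rho lam B).prod)
      (centeredMoment (fun L => partitionSum (fun l => rho lam B * U P' B Y l.get) L ![])
        (rho lam B) L []) := by
  simpa using hasIntegral_prod_sub_mul_prod (h.hasIntegral_prod_N hB hB' hB0) (rho lam B) L []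

theorem IsParticleSystem.hasIntegral_N (h : IsParticleSystem P P' lam Y ξ Yp)
    (hB : MeasurableSet B) (hB' : volume B ≠ ∞) (hB0 : volume B ≠ 0) (t : ℝ≥0) :
    HasIntegral P (N B ξ Yp t) (rho lam B) :=
  (h.hasIntegral_prod_N hB hB' hB0 [t]).congr (by simp)
    ((partitionSum_singleton _ t).trans (rho_mul_U_get_singleton hB' hB0 t))

theorem IsParticleSystem.hasIntegral_centered_mul (h : IsParticleSystem P P' lam Y ξ Yp)
    (hB : MeasurableSet B) (hB' : volume B ≠ ∞) (hB0 : volume B ≠ 0) (s t : ℝ≥0) :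
    HasIntegral P (fun ω => (N B ξ Yp s ω - rho lam B) * (N B ξ Yp t ω - rho lam B))
      (rho lam B * U P' B Y ![s, t]) := by
  refine (h.hasIntegral_prod_centered hB hB' hB0 [s, t]).congr (by simp) ?_
  rw [centeredMoment_partitionSum_pair (rho_mul_U_get_singleton hB' hB0), U_get_pair]

theorem IsParticleSystem.hasIntegral_centered_mul_four (h : IsParticleSystem P P' lam Y ξ Yp)
    (hB : MeasurableSet B) (hB' : volume B ≠ ∞) (hB0 : volume B ≠ 0) (s t u v : ℝ≥0) :
    HasIntegral P (fun ω => (N B ξ Yp s ω - rho lam B) * (N B ξ Yp t ω - rho lam B) *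
        ((N B ξ Yp u ω - rho lam B) * (N B ξ Yp v ω - rho lam B)))
      (rho lam B * U P' B Y ![s, t] * (rho lam B * U P' B Y ![u, v]) +
        rho lam B * U P' B Y ![s, u] * (rho lam B * U P' B Y ![t, v]) +
        rho lam B * U P' B Y ![s, v] * (rho lam B * U P' B Y ![t, u]) +
        rho lam B * U P' B Y ![s, t, u, v]) := by
  refine (h.hasIntegral_prod_centered hB hB' hB0 [s, t, u, v]).congr (by simp [mul_assoc]) ?_
  rw [centeredMoment_partitionSum_four (rho_mul_U_get_singleton hB' hB0)]
  simp only [U_get_pair, U_get_four]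

end Moments

section Fubini

variable {α β Ω : Type*} [MeasurableSpace α] [MeasurableSpace β] [MeasurableSpace Ω]
  {μ : Measure α} {ν : Measure β} {P : Measure Ω}

theorem integrable_prod_of_integral_norm_le [IsFiniteMeasure μ] [SFinite P] {f : α × Ω → ℝ}
    (hf : AEStronglyMeasurable f (μ.prod P)) {C : ℝ} (hint : ∀ x, Integrable (fun ω => f (x, ω)) P)
    (hC : ∀ x, ∫ ω, ‖f (x, ω)‖ ∂P ≤ C) : Integrable f (μ.prod P) := by
  refine (integrable_prod_iff hf).2 ⟨ae_of_all _ hint, ?_⟩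
  refine Integrable.of_bound (C := C) hf.norm.integral_prod_right' (ae_of_all _ fun x => ?_)
  rw [Real.norm_of_nonneg (integral_nonneg fun ω => norm_nonneg _)]
  exact hC x

variable [IsFiniteMeasure μ] [IsFiniteMeasure ν] [SFinite P] {f : α × Ω → ℝ} {g : β × Ω → ℝ}

theorem integrable_prod_mul_of_memLp_two (hf : MemLp f 2 (μ.prod P)) (hg : MemLp g 2 (ν.prod P)) :
    Integrable (fun p : (α × β) × Ω => f (p.1.1, p.2) * g (p.1.2, p.2)) ((μ.prod ν).prod P) := by
  have hfst : ((μ.prod ν).prod P).map (Prod.map Prod.fst id) = ν Set.univ • μ.prod P := by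
    rw [← Measure.map_prod_map _ _ measurable_fst measurable_id, Measure.map_id,
      Measure.map_fst_prod, Measure.prod_smul_left]
  have hsnd : ((μ.prod ν).prod P).map (Prod.map Prod.snd id) = μ Set.univ • ν.prod P := by
    rw [← Measure.map_prod_map _ _ measurable_snd measurable_id, Measure.map_id,
      Measure.map_snd_prod, Measure.prod_smul_left]
  have hf' := hfst ▸ hf.smul_measure (measure_ne_top ν Set.univ)
  have hg' := hsnd ▸ hg.smul_measure (measure_ne_top μ Set.univ)
  exact (hf'.comp_of_map (measurable_fst.prodMap measurable_id).aemeasurable).integrable_mul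
    (hg'.comp_of_map (measurable_snd.prodMap measurable_id).aemeasurable)

theorem hasIntegral_integral_mul_integral (hf : MemLp f 2 (μ.prod P))
    (hg : MemLp g 2 (ν.prod P)) :
    HasIntegral P (fun ω => (∫ x, f (x, ω) ∂μ) * ∫ y, g (y, ω) ∂ν)
      (∫ z, ∫ ω, f (z.1, ω) * g (z.2, ω) ∂P ∂μ.prod ν) := by
  have h := integrable_prod_mul_of_memLp_two hf hg
  refine HasIntegral.congr ⟨h.integral_prod_right, rfl⟩
    (fun ω => integral_prod_mul (fun x => f (x, ω)) fun y => g (y, ω)) ?_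
  exact (integral_integral_swap h).symm

theorem memLp_two_integral (hf : MemLp f 2 (μ.prod P)) :
    MemLp (fun ω => ∫ x, f (x, ω) ∂μ) 2 P := by
  have hmeas : AEStronglyMeasurable (fun ω => ∫ x, f (x, ω) ∂μ) P :=
    hf.1.prod_swap.integral_prod_right'
  refine (memLp_two_iff_integrable_sq hmeas).2 ?_
  simpa only [sq] using (hasIntegral_integral_mul_integral hf hf).1

end Fubini

section IntervalIntegrals

theorem volume_restrict_prod (A B : Set ℝ) :
    volume.restrict (A ×ˢ B) = (volume.restrict A).prod (volume.restrict B) := by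
  rw [Measure.volume_eq_prod, Measure.prod_restrict]

theorem setIntegral_Icc_prod_Icc {f : ℝ × ℝ → ℝ} {a b : ℝ} (ha : 0 ≤ a) (hb : 0 ≤ b)
    (hf : IntegrableOn f (Set.Icc 0 a ×ˢ Set.Icc 0 b) volume) :
    ∫ τ in Set.Icc 0 a ×ˢ Set.Icc 0 b, f τ =
      ∫ y in (0 : ℝ)..b, ∫ x in (0 : ℝ)..a, f (x, y) := by
  rw [IntegrableOn, volume_restrict_prod] at hf
  rw [volume_restrict_prod, integral_prod_symm _ hf, intervalIntegral.integral_of_le hb,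
    integral_Icc_eq_integral_Ioc]
  simp_rw [intervalIntegral.integral_of_le ha, integral_Icc_eq_integral_Ioc]

theorem quasiMeasurePreserving_sub_add (c : ℝ) :
    Measure.QuasiMeasurePreserving (fun τ : ℝ × ℝ => τ.1 - τ.2 + c) volume volume :=
  (measurePreserving_add_right volume c).quasiMeasurePreserving.comp
    (quasiMeasurePreserving_sub_of_right_invariant volume volume)

theorem toNNReal_sub_toNNReal_neg (x : ℝ) : (x.toNNReal : ℝ) - (-x).toNNReal = x := by
  simp only [Real.coe_toNNReal', max_zero_sub_max_neg_zero_eq_self]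

theorem intervalIntegral_neg_self_of_even {f : ℝ → ℝ} (hf : ∀ x, f (-x) = f x)
    (hint : ∀ a b, IntervalIntegrable f volume a b) (T : ℝ) :
    ∫ y in (-T)..T, f y = 2 * ∫ y in (0 : ℝ)..T, f y := by
  have hneg := intervalIntegral.integral_comp_neg (a := 0) (b := T) f
  simp only [hf, neg_zero] at hneg
  rw [← intervalIntegral.integral_add_adjacent_intervals (hint (-T) 0) (hint 0 T), ← hneg, two_mul]

end IntervalIntegrals

section EmpiricalCovariance

/-- `Z` is a measurable process on `[0, ∞)` with mean `m`, covariance `r (s - t)` between the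
times `s` and `t`, and fourth joint cumulant `κ`. The cumulants `κ ![s, t, s, t]` are bounded, which
makes the products `(Z s - m) * (Z t - m)` bounded in `L²`. -/
structure HasCumulants {Ω : Type*} [MeasurableSpace Ω] (P : Measure Ω) (Z : ℝ≥0 → Ω → ℝ) (m : ℝ)
    (r : ℝ → ℝ) (κ : (Fin 4 → ℝ≥0) → ℝ) : Prop where
  aemeasurable : AEMeasurable (fun p : ℝ × Ω => Z p.1.toNNReal p.2) (volume.prod P)
  hasIntegral : ∀ t, HasIntegral P (Z t) m
  hasIntegral_mul : ∀ s t : ℝ≥0, HasIntegral P (fun ω => (Z s ω - m) * (Z t ω - m)) (r (s - t))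
  hasIntegral_mul_four : ∀ s t u v : ℝ≥0,
    HasIntegral P (fun ω => (Z s ω - m) * (Z t ω - m) * ((Z u ω - m) * (Z v ω - m)))
      (r (s - t) * r (u - v) + r (s - u) * r (t - v) + r (s - v) * r (t - u) + κ ![s, t, u, v])
  cumulant_bddAbove : ∃ c, ∀ s t, κ ![s, t, s, t] ≤ c

namespace HasCumulants

variable {Ω : Type*} [MeasurableSpace Ω] {P : Measure Ω} {Z : ℝ≥0 → Ω → ℝ} {m : ℝ} {r : ℝ → ℝ}
  {κ : (Fin 4 → ℝ≥0) → ℝ}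

theorem hasIntegral_posPart_mul_negPart (h : HasCumulants P Z m r κ) (x : ℝ) :
    HasIntegral P (fun ω => (Z x.toNNReal ω - m) * (Z (-x).toNNReal ω - m)) (r x) := by
  simpa only [toNNReal_sub_toNNReal_neg] using h.hasIntegral_mul x.toNNReal (-x).toNNReal

theorem covariance_neg (h : HasCumulants P Z m r κ) (x : ℝ) : r (-x) = r x := by
  rw [← (h.hasIntegral_posPart_mul_negPart x).2, ← (h.hasIntegral_posPart_mul_negPart (-x)).2,
    neg_neg]
  simp only [mul_comm]

theorem abs_covariance_le (h : HasCumulants P Z m r κ) (x : ℝ) : |r x| ≤ r 0 := by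
  obtain ⟨hint, heq⟩ := h.hasIntegral_posPart_mul_negPart x
  have hvar (t : ℝ≥0) : HasIntegral P (fun ω => (Z t ω - m) * (Z t ω - m)) (r 0) := by
    simpa only [sub_self] using h.hasIntegral_mul t t
  have hsq := ((hvar x.toNNReal).1.add (hvar (-x).toNNReal).1).div_const 2
  calc |r x| ≤ ∫ ω, |(Z x.toNNReal ω - m) * (Z (-x).toNNReal ω - m)| ∂P :=
        heq ▸ abs_integral_le_integral_abs
    _ ≤ ∫ ω, ((Z x.toNNReal ω - m) * (Z x.toNNReal ω - m) +
          (Z (-x).toNNReal ω - m) * (Z (-x).toNNReal ω - m)) / 2 ∂P := by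
        refine integral_mono hint.abs hsq fun ω => ?_
        rw [abs_mul]
        nlinarith [two_mul_le_add_sq |Z x.toNNReal ω - m| |Z (-x).toNNReal ω - m|,
          sq_abs (Z x.toNNReal ω - m), sq_abs (Z (-x).toNNReal ω - m)]
    _ = r 0 := by
        rw [integral_div, integral_add (hvar _).1 (hvar _).1, (hvar _).2, (hvar _).2,
          add_self_div_two]

theorem R_eq (h : HasCumulants P Z m r κ) {t : ℝ} (ht : 0 ≤ t) : R P Z t = r t := by
  rw [R, covariance, (h.hasIntegral _).2, (h.hasIntegral _).2, (h.hasIntegral_mul _ _).2,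
    NNReal.coe_zero, zero_sub, h.covariance_neg, Real.coe_toNNReal t ht]

theorem exists_integral_sq_le (h : HasCumulants P Z m r κ) :
    ∃ C, ∀ s t : ℝ≥0, Integrable (fun ω => ((Z s ω - m) * (Z t ω - m)) ^ 2) P ∧
      ∫ ω, ((Z s ω - m) * (Z t ω - m)) ^ 2 ∂P ≤ C := by
  obtain ⟨c, hc⟩ := h.cumulant_bddAbove
  refine ⟨r 0 * r 0 + r 0 * r 0 + r 0 * r 0 + c, fun s t => ?_⟩
  obtain ⟨hint, heq⟩ := h.hasIntegral_mul_four s t s t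
  have hr (x y : ℝ) : r x * r y ≤ r 0 * r 0 := by
    refine (le_abs_self _).trans ?_
    rw [abs_mul]
    exact mul_le_mul (h.abs_covariance_le x) (h.abs_covariance_le y) (abs_nonneg _)
      ((abs_nonneg _).trans (h.abs_covariance_le x))
  simp only [sq ((Z s _ - m) * (Z t _ - m))]
  exact ⟨hint, heq.trans_le (by gcongr ?_ + ?_ + ?_ + ?_ <;> first | exact hr _ _ | exact hc s t)⟩

variable [IsProbabilityMeasure P]

theorem aestronglyMeasurable_covariance (h : HasCumulants P Z m r κ) :
    AEStronglyMeasurable r volume := by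
  have hneg : Measure.QuasiMeasurePreserving (Prod.map (fun u : ℝ => -u) (id : Ω → Ω))
      (volume.prod P) (volume.prod P) :=
    ((Measure.measurePreserving_neg (volume : Measure ℝ)).prod (.id P)).quasiMeasurePreserving
  have hmeas := ((h.aemeasurable.sub_const m).mul
    ((h.aemeasurable.comp_quasiMeasurePreserving hneg).sub_const m)).aestronglyMeasurable
  exact hmeas.integral_prod_right'.congr
    (ae_of_all _ fun x => (h.hasIntegral_posPart_mul_negPart x).2)

theorem intervalIntegrable_covariance (h : HasCumulants P Z m r κ) (a b : ℝ) :
    IntervalIntegrable r volume a b :=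
  (intervalIntegrable_const (c := r 0)).mono_fun' h.aestronglyMeasurable_covariance.restrict
    (ae_of_all _ h.abs_covariance_le)

theorem integrableOn_covariance_sub_add (h : HasCumulants P Z m r κ) (c : ℝ) {A : Set (ℝ × ℝ)}
    (hA : volume A ≠ ∞) : IntegrableOn (fun τ : ℝ × ℝ => r (τ.1 - τ.2 + c)) A volume :=
  IntegrableOn.of_bound hA.lt_top (h.aestronglyMeasurable_covariance.comp_quasiMeasurePreserving
    (quasiMeasurePreserving_sub_add c)).restrict (r 0) (ae_of_all _ fun _ => h.abs_covariance_le _)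

theorem integrableOn_covariance_mul_covariance (h : HasCumulants P Z m r κ) (a b : ℝ)
    {A : Set (ℝ × ℝ)} (hA : volume A ≠ ∞) :
    IntegrableOn (fun τ : ℝ × ℝ => r (τ.1 - τ.2 + a) * r (τ.1 - τ.2 + b)) A volume :=
  (h.integrableOn_covariance_sub_add a hA).mul_bdd
    (h.integrableOn_covariance_sub_add b hA).aestronglyMeasurable
    (ae_of_all _ fun _ => h.abs_covariance_le _)

theorem integrableOn_covariance_pairings (h : HasCumulants P Z m r κ) (t s : ℝ) {A : Set (ℝ × ℝ)}
    (hA : volume A ≠ ∞) :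
    IntegrableOn (fun τ : ℝ × ℝ => r (τ.1 - τ.2) * r (τ.1 - τ.2 + t - s) +
      r (τ.1 - τ.2 - s) * r (τ.1 - τ.2 + t)) A volume := by
  refine ((h.integrableOn_covariance_mul_covariance 0 (t - s) hA).add
    (h.integrableOn_covariance_mul_covariance (-s) t hA)).congr (ae_of_all _ fun τ => ?_)
  simp only [Pi.add_apply, add_zero, add_sub_assoc, ← sub_eq_add_neg]

theorem aestronglyMeasurable_empIntegrand (h : HasCumulants P Z m r κ) (t : ℝ) :
    AEStronglyMeasurable (fun p : ℝ × Ω => empIntegrand Z m t p.2 p.1) (volume.prod P) := by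
  have hadd : Measure.QuasiMeasurePreserving (Prod.map (fun u : ℝ => t + u) (id : Ω → Ω))
      (volume.prod P) (volume.prod P) :=
    ((measurePreserving_add_left volume t).prod (.id P)).quasiMeasurePreserving
  exact ((h.aemeasurable.sub_const m).mul
    ((h.aemeasurable.comp_quasiMeasurePreserving hadd).sub_const m)).aestronglyMeasurable

theorem memLp_empIntegrand_sub (h : HasCumulants P Z m r κ) (t c : ℝ) {μ : Measure ℝ}
    [IsFiniteMeasure μ] (hμ : μ ≪ volume) :
    MemLp (fun p : ℝ × Ω => empIntegrand Z m t p.2 p.1 - c) 2 (μ.prod P) := by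
  have hmeas := (h.aestronglyMeasurable_empIntegrand t).mono_ac (hμ.prod .rfl)
  obtain ⟨C, hC⟩ := h.exists_integral_sq_le
  refine MemLp.sub ((memLp_two_iff_integrable_sq hmeas).2 ?_) (memLp_const c)
  refine integrable_prod_of_integral_norm_le (C := C) (hmeas.pow 2)
    (fun x => (hC x.toNNReal (t + x).toNNReal).1) fun x => ?_
  simpa only [empIntegrand, norm_pow, Real.norm_eq_abs, sq_abs] using
    (hC x.toNNReal (t + x).toNNReal).2

theorem ae_intervalIntegrable_empIntegrand (h : HasCumulants P Z m r κ) {t T : ℝ} (htT : t ≤ T) :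
    ∀ᵐ ω ∂P, IntervalIntegrable (empIntegrand Z m t ω) volume 0 (T - t) := by
  have hmem := h.memLp_empIntegrand_sub t 0
    (Measure.restrict_le_self (s := Set.Icc 0 (T - t))).absolutelyContinuous
  filter_upwards [(hmem.integrable one_le_two).prod_left_ae] with ω hω
  rw [intervalIntegrable_iff_integrableOn_Icc_of_le (sub_nonneg.2 htT), IntegrableOn]
  simpa only [sub_zero] using hω

theorem ae_mul_Rhat_sub_R (h : HasCumulants P Z m r κ) {t T : ℝ} (htT : t < T) :
    ∀ᵐ ω ∂P, (T - t) * (Rhat Z m T t ω - R P Z t) =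
      ∫ u in Set.Icc 0 (T - t), (empIntegrand Z m t ω u - R P Z t) := by
  have hpos : 0 < T - t := sub_pos.2 htT
  filter_upwards [h.ae_intervalIntegrable_empIntegrand htT.le] with ω hω
  rw [intervalIntegrable_iff_integrableOn_Icc_of_le hpos.le] at hω
  rw [integral_sub hω (integrable_const _), Rhat, intervalIntegral.integral_of_le hpos.le,
    ← integral_Icc_eq_integral_Ioc, setIntegral_const, Real.volume_real_Icc_of_le hpos.le,
    sub_zero, smul_eq_mul]
  field_simp

theorem memLp_Rhat_sub_R (h : HasCumulants P Z m r κ) {t T : ℝ} (htT : t < T) :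
    MemLp (fun ω => Rhat Z m T t ω - R P Z t) 2 P := by
  have hmem := memLp_two_integral (h.memLp_empIntegrand_sub t (R P Z t)
    (Measure.restrict_le_self (s := Set.Icc 0 (T - t))).absolutelyContinuous)
  refine (hmem.const_mul (T - t)⁻¹).ae_eq ?_
  filter_upwards [h.ae_mul_Rhat_sub_R htT] with ω hω
  rw [← hω, inv_mul_cancel_left₀ (sub_pos.2 htT).ne']

theorem hasIntegral_empIntegrand_sub_mul (h : HasCumulants P Z m r κ) {t s x y : ℝ} (ht : 0 ≤ t)
    (hs : 0 ≤ s) (hx : 0 ≤ x) (hy : 0 ≤ y) :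
    HasIntegral P (fun ω => (empIntegrand Z m t ω x - r t) * (empIntegrand Z m s ω y - r s))
      (r (x - y) * r (x - y + t - s) + r (x - y - s) * r (x - y + t) +
        κ ![x.toNNReal, (x + t).toNNReal, y.toNNReal, (y + s).toNNReal]) := by
  have hone : HasIntegral P (fun _ => (1 : ℝ)) 1 := ⟨integrable_const _, by simp⟩
  have hfour := h.hasIntegral_mul_four x.toNNReal (x + t).toNNReal y.toNNReal (y + s).toNNReal
  have hlag {a b : ℝ} (ha : 0 ≤ a) (hb : 0 ≤ b) :
      HasIntegral P (fun ω => (Z a.toNNReal ω - m) * (Z (a + b).toNNReal ω - m)) (r b) := by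
    simpa only [Real.coe_toNNReal _ ha, Real.coe_toNNReal _ (add_nonneg ha hb), sub_add_cancel_left,
      h.covariance_neg] using h.hasIntegral_mul a.toNNReal (a + b).toNNReal
  refine ((hfour.sub ((hlag hx ht).const_mul (r s))).sub
    (((hlag hy hs).sub (hone.const_mul (r s))).const_mul (r t))).congr (fun ω => ?_) ?_
  · simp only [empIntegrand, add_comm t x, add_comm s y]
    ring
  · have hcross : x - (y + s) = x - y - s := by ring
    have hends : x + t - (y + s) = x - y + t - s := by ring
    have hswap : x + t - y = x - y + t := by ring
    simp only [Real.coe_toNNReal _ hx, Real.coe_toNNReal _ hy,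
      Real.coe_toNNReal _ (add_nonneg hx ht), Real.coe_toNNReal _ (add_nonneg hy hs),
      sub_add_cancel_left, h.covariance_neg, hcross, hends, hswap]
    ring

theorem eqOn_integral_empIntegrand_sub_mul (h : HasCumulants P Z m r κ) {t s a b : ℝ}
    (ht : 0 ≤ t) (hs : 0 ≤ s) :
    Set.EqOn (fun τ : ℝ × ℝ =>
        ∫ ω, (empIntegrand Z m t ω τ.1 - R P Z t) * (empIntegrand Z m s ω τ.2 - R P Z s) ∂P)
      (fun τ => (r (τ.1 - τ.2) * r (τ.1 - τ.2 + t - s) + r (τ.1 - τ.2 - s) * r (τ.1 - τ.2 + t)) +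
        κ ![τ.1.toNNReal, (τ.1 + t).toNNReal, τ.2.toNNReal, (τ.2 + s).toNNReal])
      (Set.Icc 0 a ×ˢ Set.Icc 0 b) := fun τ hτ => by
  simpa only [h.R_eq ht, h.R_eq hs] using
    (h.hasIntegral_empIntegrand_sub_mul ht hs hτ.1.1 hτ.2.1).2

theorem integrableOn_cumulant (h : HasCumulants P Z m r κ) {t s : ℝ} (ht : 0 ≤ t) (hs : 0 ≤ s)
    (a b : ℝ) :
    IntegrableOn (fun τ : ℝ × ℝ =>
        κ ![τ.1.toNNReal, (τ.1 + t).toNNReal, τ.2.toNNReal, (τ.2 + s).toNNReal])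
      (Set.Icc 0 a ×ˢ Set.Icc 0 b) volume := by
  have hmem (t : ℝ) (a : ℝ) := h.memLp_empIntegrand_sub t (R P Z t)
    (Measure.restrict_le_self (s := Set.Icc 0 a)).absolutelyContinuous
  have hint := (integrable_prod_mul_of_memLp_two (hmem t a) (hmem s b)).integral_prod_left
  rw [← volume_restrict_prod] at hint
  refine ((IntegrableOn.congr_fun hint (h.eqOn_integral_empIntegrand_sub_mul ht hs)
    (measurableSet_Icc.prod measurableSet_Icc)).sub (h.integrableOn_covariance_pairings t s
      (isCompact_Icc.prod isCompact_Icc).measure_ne_top)).congr (ae_of_all _ fun τ => ?_)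
  exact add_sub_cancel_left _ _

theorem integral_Rhat_sub_R_mul (h : HasCumulants P Z m r κ) {t s T : ℝ} (ht : 0 ≤ t) (htT : t < T)
    (hs : 0 ≤ s) (hsT : s < T) :
    (T - s) * (T - t) * ∫ ω, (Rhat Z m T t ω - R P Z t) * (Rhat Z m T s ω - R P Z s) ∂P =
      (∫ τ in Set.Icc 0 (T - t) ×ˢ Set.Icc 0 (T - s),
        (r (τ.1 - τ.2) * r (τ.1 - τ.2 + t - s) + r (τ.1 - τ.2 - s) * r (τ.1 - τ.2 + t))) +
      ∫ τ in Set.Icc 0 (T - t) ×ˢ Set.Icc 0 (T - s),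
        κ ![τ.1.toNNReal, (τ.1 + t).toNNReal, τ.2.toNNReal, (τ.2 + s).toNNReal] := by
  have hmem (t : ℝ) := h.memLp_empIntegrand_sub t (R P Z t)
    (Measure.restrict_le_self (s := Set.Icc 0 (T - t))).absolutelyContinuous
  have hfubini := (hasIntegral_integral_mul_integral (hmem t) (hmem s)).2
  rw [← volume_restrict_prod] at hfubini
  rw [← integral_add (h.integrableOn_covariance_pairings t s
      (isCompact_Icc.prod isCompact_Icc).measure_ne_top) (h.integrableOn_cumulant ht hs _ _),
    ← setIntegral_congr_fun (measurableSet_Icc.prod measurableSet_Icc)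
      (h.eqOn_integral_empIntegrand_sub_mul ht hs), ← hfubini, ← integral_const_mul]
  refine integral_congr_ae ?_
  filter_upwards [h.ae_mul_Rhat_sub_R htT, h.ae_mul_Rhat_sub_R hsT] with ω hωt hωs
  rw [← hωt, ← hωs]
  ring

theorem setIntegral_covariance_sub_add_le (h : HasCumulants P Z m r κ) (hr : ∀ x, 0 ≤ r x)
    {t T c : ℝ} (htT : t ≤ T) (hc : 0 ≤ c) (hct : c ≤ t) :
    ∫ τ in Set.Icc 0 (T - t) ×ˢ Set.Icc 0 (T - t), r (τ.1 - τ.2 + c) ≤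
      (T - t) * (2 * ∫ y in (0 : ℝ)..T, r y) := by
  have hT : 0 ≤ T - t := sub_nonneg.2 htT
  have hint := h.integrableOn_covariance_sub_add c
    (A := Set.Icc 0 (T - t) ×ˢ Set.Icc 0 (T - t))
    (isCompact_Icc.prod isCompact_Icc).measure_ne_top
  rw [IntegrableOn, volume_restrict_prod] at hint
  have hslice : ∀ y ∈ Set.Icc 0 (T - t),
      ∫ x in Set.Icc 0 (T - t), r (x - y + c) ≤ 2 * ∫ y in (0 : ℝ)..T, r y := by
    intro y hy
    rw [integral_Icc_eq_integral_Ioc, ← intervalIntegral.integral_of_le hT,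
      ← intervalIntegral_neg_self_of_even h.covariance_neg h.intervalIntegrable_covariance]
    simp_rw [sub_add]
    rw [intervalIntegral.integral_comp_sub_right]
    exact intervalIntegral.integral_mono_interval (by linarith [hy.2]) (by linarith)
      (by linarith [hy.1]) (ae_of_all _ hr) (h.intervalIntegrable_covariance _ _)
  calc ∫ τ in Set.Icc 0 (T - t) ×ˢ Set.Icc 0 (T - t), r (τ.1 - τ.2 + c)
      = ∫ y in Set.Icc 0 (T - t), ∫ x in Set.Icc 0 (T - t), r (x - y + c) := by
        rw [volume_restrict_prod, integral_prod_symm _ hint]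
    _ ≤ ∫ _ in Set.Icc 0 (T - t), 2 * ∫ y in (0 : ℝ)..T, r y :=
        setIntegral_mono_on hint.integral_prod_right (integrable_const _) measurableSet_Icc hslice
    _ = (T - t) * (2 * ∫ y in (0 : ℝ)..T, r y) := by simp [hT]

theorem setIntegral_covariance_pairings_le (h : HasCumulants P Z m r κ) (hr : ∀ x, 0 ≤ r x)
    {t T : ℝ} (ht : 0 ≤ t) (htT : t ≤ T) :
    ∫ τ in Set.Icc 0 (T - t) ×ˢ Set.Icc 0 (T - t),
        (r (τ.1 - τ.2) * r (τ.1 - τ.2 + t - t) + r (τ.1 - τ.2 - t) * r (τ.1 - τ.2 + t)) ≤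
      (T - t) * (4 * r 0 * ∫ y in (0 : ℝ)..T, r y) := by
  have hfin : volume (Set.Icc 0 (T - t) ×ˢ Set.Icc 0 (T - t)) ≠ ∞ :=
    (isCompact_Icc.prod isCompact_Icc).measure_ne_top
  have hint (c : ℝ) := (h.integrableOn_covariance_sub_add c hfin).const_mul (r 0)
  have hle (x : ℝ) : r x ≤ r 0 := (le_abs_self _).trans (h.abs_covariance_le x)
  calc ∫ τ in Set.Icc 0 (T - t) ×ˢ Set.Icc 0 (T - t),
        (r (τ.1 - τ.2) * r (τ.1 - τ.2 + t - t) + r (τ.1 - τ.2 - t) * r (τ.1 - τ.2 + t))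
      ≤ ∫ τ in Set.Icc 0 (T - t) ×ˢ Set.Icc 0 (T - t),
          (r 0 * r (τ.1 - τ.2 + 0) + r 0 * r (τ.1 - τ.2 + t)) := by
        refine integral_mono (h.integrableOn_covariance_pairings t t hfin)
          ((hint 0).add (hint t)) fun τ => ?_
        simp only [add_sub_cancel_right, add_zero]
        gcongr <;> first | exact hr _ | exact hle _
    _ = r 0 * (∫ τ in Set.Icc 0 (T - t) ×ˢ Set.Icc 0 (T - t), r (τ.1 - τ.2 + 0)) +
          r 0 * ∫ τ in Set.Icc 0 (T - t) ×ˢ Set.Icc 0 (T - t), r (τ.1 - τ.2 + t) := by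
        rw [integral_add (hint 0) (hint t), integral_const_mul, integral_const_mul]
    _ ≤ r 0 * ((T - t) * (2 * ∫ y in (0 : ℝ)..T, r y)) +
          r 0 * ((T - t) * (2 * ∫ y in (0 : ℝ)..T, r y)) := by
        gcongr
        exacts [hr 0, h.setIntegral_covariance_sub_add_le hr htT le_rfl ht, hr 0,
          h.setIntegral_covariance_sub_add_le hr htT ht le_rfl]
    _ = (T - t) * (4 * r 0 * ∫ y in (0 : ℝ)..T, r y) := by ring

theorem setIntegral_cumulant_le (h : HasCumulants P Z m r κ) (hr : ∀ x, 0 ≤ r x)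
    (hκ : ∀ s t u v : ℝ≥0, κ ![s, t, u, v] ≤ r (s - u)) {t T : ℝ} (ht : 0 ≤ t) (htT : t ≤ T) :
    ∫ τ in Set.Icc 0 (T - t) ×ˢ Set.Icc 0 (T - t),
        κ ![τ.1.toNNReal, (τ.1 + t).toNNReal, τ.2.toNNReal, (τ.2 + t).toNNReal] ≤
      (T - t) * (2 * ∫ y in (0 : ℝ)..T, r y) := by
  refine le_trans ?_ (h.setIntegral_covariance_sub_add_le hr htT le_rfl ht)
  refine setIntegral_mono_on (h.integrableOn_cumulant ht ht _ _)
    (h.integrableOn_covariance_sub_add 0 (isCompact_Icc.prod isCompact_Icc).measure_ne_top)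
    (measurableSet_Icc.prod measurableSet_Icc) fun τ hτ => ?_
  simpa only [Real.coe_toNNReal _ hτ.1.1, Real.coe_toNNReal _ hτ.2.1, add_zero] using
    hκ τ.1.toNNReal (τ.1 + t).toNNReal τ.2.toNNReal (τ.2 + t).toNNReal

theorem integral_sq_Rhat_sub_R_le (h : HasCumulants P Z m r κ) (hr : ∀ x, 0 ≤ r x)
    (hκ : ∀ s t u v : ℝ≥0, κ ![s, t, u, v] ≤ r (s - u)) {t T : ℝ} (ht : 0 ≤ t) (htT : t < T) :
    ∫ ω, |Rhat Z m T t ω - R P Z t| ^ 2 ∂P ≤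
      (4 * r 0 + 2) / (T - t) * ∫ y in (0 : ℝ)..T, r y := by
  have hpos : 0 < T - t := sub_pos.2 htT
  have hbound := add_le_add (h.setIntegral_covariance_pairings_le hr ht htT.le)
    (h.setIntegral_cumulant_le hr hκ ht htT.le)
  rw [← h.integral_Rhat_sub_R_mul ht htT ht htT, mul_assoc, ← mul_add, ← add_mul] at hbound
  simp only [sq_abs, sq (Rhat _ _ _ _ _ - _)]
  rw [div_mul_eq_mul_div, le_div_iff₀' hpos]
  exact le_of_mul_le_mul_left hbound hpos

end HasCumulants

end EmpiricalCovariance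

section Stationarity

/-- The covariances of `Z` are invariant under time shifts, so that they are functions of the
lag; the means may depend on time. -/
def IsCovarianceStationary {Ω : Type*} [MeasurableSpace Ω] (P : Measure Ω) (Z : ℝ≥0 → Ω → ℝ) :
    Prop :=
  ∀ s t τ : ℝ≥0, cov[Z (s + τ), Z (t + τ); P] = cov[Z s, Z t; P]

theorem IsStrictlyStationary.isCovarianceStationary {Ω : Type*} [MeasurableSpace Ω]
    {P : Measure Ω} {Z : ℝ≥0 → Ω → ℝ} (hs : IsStrictlyStationary P Z) :
    IsCovarianceStationary P Z := by
  intro s t τ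
  have hpair := hs 2 ![s, t] τ
  have hmean_left : ∫ ω, Z (s + τ) ω ∂P = ∫ ω, Z s ω ∂P :=
    (hpair.comp (measurable_pi_apply 0)).integral_eq
  have hmean_right : ∫ ω, Z (t + τ) ω ∂P = ∫ ω, Z t ω ∂P :=
    (hpair.comp (measurable_pi_apply 1)).integral_eq
  rw [covariance, covariance, hmean_left, hmean_right]
  exact (hpair.comp (u := fun x : Fin 2 → ℝ =>
    (x 0 - ∫ ω, Z s ω ∂P) * (x 1 - ∫ ω, Z t ω ∂P)) (by fun_prop)).integral_eq

end Stationarity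

section SmoluchowskiProcess

variable {d : ℕ} {Ω Ω' : Type*} [MeasurableSpace Ω] [MeasurableSpace Ω'] {P : Measure Ω}
  [IsProbabilityMeasure P] {P' : Measure Ω'} [IsProbabilityMeasure P'] {lam : ℝ≥0}
  {B : Set (EuclideanSpace ℝ (Fin d))} {Y : ℝ≥0 → Ω' → EuclideanSpace ℝ (Fin d)}
  {ξ : ℤ → Ω → EuclideanSpace ℝ (Fin d)} {Yp : ℤ → ℝ≥0 → Ω → EuclideanSpace ℝ (Fin d)}

namespace IsParticleSystem

omit [IsProbabilityMeasure P'] in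
theorem rho_pos (h : IsParticleSystem P P' lam Y ξ Yp) (hB' : volume B ≠ ∞)
    (hB0 : volume B ≠ 0) : 0 < rho lam B :=
  mul_pos (by exact_mod_cast h.poisson.rate_pos) (ENNReal.toReal_pos hB0 hB')

theorem covariance_N (h : IsParticleSystem P P' lam Y ξ Yp) (hB : MeasurableSet B)
    (hB' : volume B ≠ ∞) (hB0 : volume B ≠ 0) (s t : ℝ≥0) :
    cov[N B ξ Yp s, N B ξ Yp t; P] = rho lam B * U P' B Y ![s, t] := by
  rw [covariance, (h.hasIntegral_N hB hB' hB0 s).2, (h.hasIntegral_N hB hB' hB0 t).2,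
    (h.hasIntegral_centered_mul hB hB' hB0 s t).2]

theorem U_pair_eq_H (h : IsParticleSystem P P' lam Y ξ Yp) (hB : MeasurableSet B)
    (hB' : volume B ≠ ∞) (hB0 : volume B ≠ 0) (hs : IsCovarianceStationary P (N B ξ Yp))
    (s t : ℝ≥0) : U P' B Y ![s, t] = H P' B Y (s - t) := by
  have hrho := (h.rho_pos hB' hB0).ne'
  have hshift (s t τ : ℝ≥0) : U P' B Y ![s + τ, t + τ] = U P' B Y ![s, t] :=
    mul_left_cancel₀ hrho (by simpa only [h.covariance_N hB hB' hB0] using hs s t τ)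
  have hsymm (s t : ℝ≥0) : U P' B Y ![s, t] = U P' B Y ![t, s] := by
    refine mul_left_cancel₀ hrho ?_
    rw [← h.covariance_N hB hB' hB0, ← h.covariance_N hB hB' hB0, covariance_comm]
  wlog hst : s ≤ t generalizing s t
  · rw [hsymm, this t s (le_of_not_ge hst), ← H_neg, neg_sub]
  have hlag : Real.nnabs ((s : ℝ) - t) = t - s := by
    ext
    rw [Real.coe_nnabs, abs_sub_comm, NNReal.coe_sub hst,
      abs_of_nonneg (sub_nonneg.2 (NNReal.coe_le_coe.2 hst))]
  rw [H_eq_U h.generic_zero, hlag, ← hshift 0 (t - s) s, zero_add, tsub_add_cancel_of_le hst]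

theorem hasCumulants (h : IsParticleSystem P P' lam Y ξ Yp) (hB : MeasurableSet B)
    (hB' : volume B ≠ ∞) (hB0 : volume B ≠ 0)
    (hN : AEMeasurable (fun p : ℝ × Ω => N B ξ Yp p.1.toNNReal p.2) (volume.prod P))
    (hs : IsCovarianceStationary P (N B ξ Yp)) :
    HasCumulants P (N B ξ Yp) (rho lam B) (fun x => rho lam B * H P' B Y x)
      (fun t => rho lam B * U P' B Y t) where
  aemeasurable := hN
  hasIntegral := h.hasIntegral_N hB hB' hB0
  hasIntegral_mul s t := by
    simpa only [h.U_pair_eq_H hB hB' hB0 hs] using h.hasIntegral_centered_mul hB hB' hB0 s t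
  hasIntegral_mul_four s t u v := by
    simpa only [h.U_pair_eq_H hB hB' hB0 hs] using
      h.hasIntegral_centered_mul_four hB hB' hB0 s t u v
  cumulant_bddAbove := ⟨rho lam B, fun _ _ =>
    mul_le_of_le_one_right rho_nonneg (U_le_one hB hB' hB0 h.measurable_generic _)⟩

theorem U_four_le_H (h : IsParticleSystem P P' lam Y ξ Yp) (hB : MeasurableSet B)
    (hB' : volume B ≠ ∞) (hB0 : volume B ≠ 0) (hs : IsCovarianceStationary P (N B ξ Yp))
    (s t u v : ℝ≥0) : U P' B Y ![s, t, u, v] ≤ H P' B Y (s - u) := by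
  have hsub : ![s, t, u, v] ∘ (![0, 2] : Fin 2 → Fin 4) = ![s, u] := by
    funext i
    fin_cases i <;> rfl
  rw [← h.U_pair_eq_H hB hB' hB0 hs, ← hsub]
  exact U_le_U_comp hB hB' h.measurable_generic _ _

theorem intervalIntegrable_H (h : IsParticleSystem P P' lam Y ξ Yp) (hB : MeasurableSet B)
    (hB' : volume B ≠ ∞) (hB0 : volume B ≠ 0)
    (hN : AEMeasurable (fun p : ℝ × Ω => N B ξ Yp p.1.toNNReal p.2) (volume.prod P))
    (hs : IsCovarianceStationary P (N B ξ Yp)) (a b : ℝ) :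
    IntervalIntegrable (H P' B Y) volume a b := by
  simpa only [inv_mul_cancel_left₀ (h.rho_pos hB' hB0).ne'] using
    ((h.hasCumulants hB hB' hB0 hN hs).intervalIntegrable_covariance a b).const_mul (rho lam B)⁻¹

theorem integrableOn_H_pairings (h : IsParticleSystem P P' lam Y ξ Yp) (hB : MeasurableSet B)
    (hB' : volume B ≠ ∞) (hB0 : volume B ≠ 0)
    (hN : AEMeasurable (fun p : ℝ × Ω => N B ξ Yp p.1.toNNReal p.2) (volume.prod P))
    (hs : IsCovarianceStationary P (N B ξ Yp)) (t s : ℝ) {A : Set (ℝ × ℝ)} (hA : volume A ≠ ∞) :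
    IntegrableOn (fun τ : ℝ × ℝ => H P' B Y (τ.1 - τ.2) * H P' B Y (τ.1 - τ.2 + t - s) +
      H P' B Y (τ.1 - τ.2 - s) * H P' B Y (τ.1 - τ.2 + t)) A volume := by
  refine (((h.hasCumulants hB hB' hB0 hN hs).integrableOn_covariance_pairings t s hA).const_mul
    (rho lam B ^ 2)⁻¹).congr (ae_of_all _ fun τ => ?_)
  have hrho := (h.rho_pos hB' hB0).ne'
  simp only
  field_simp

theorem integrableOn_U (h : IsParticleSystem P P' lam Y ξ Yp) (hB : MeasurableSet B)
    (hB' : volume B ≠ ∞) (hB0 : volume B ≠ 0)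
    (hN : AEMeasurable (fun p : ℝ × Ω => N B ξ Yp p.1.toNNReal p.2) (volume.prod P))
    (hs : IsCovarianceStationary P (N B ξ Yp)) {t s : ℝ} (ht : 0 ≤ t) (hs0 : 0 ≤ s) (a b : ℝ) :
    IntegrableOn (fun τ : ℝ × ℝ =>
        U P' B Y ![τ.1.toNNReal, (τ.1 + t).toNNReal, τ.2.toNNReal, (τ.2 + s).toNNReal])
      (Set.Icc 0 a ×ˢ Set.Icc 0 b) volume := by
  refine (((h.hasCumulants hB hB' hB0 hN hs).integrableOn_cumulant ht hs0 a b).const_mul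
    (rho lam B)⁻¹).congr (ae_of_all _ fun τ => ?_)
  exact inv_mul_cancel_left₀ (h.rho_pos hB' hB0).ne' _

theorem integral_Rhat_sub_R_mul (h : IsParticleSystem P P' lam Y ξ Yp) (hB : MeasurableSet B)
    (hB' : volume B ≠ ∞) (hB0 : volume B ≠ 0)
    (hN : AEMeasurable (fun p : ℝ × Ω => N B ξ Yp p.1.toNNReal p.2) (volume.prod P))
    (hs : IsCovarianceStationary P (N B ξ Yp)) {t s T : ℝ} (ht : 0 ≤ t) (htT : t < T)
    (hs0 : 0 ≤ s) (hsT : s < T) :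
    (T - s) * (T - t) *
        ∫ ω, (Rhat (N B ξ Yp) (rho lam B) T t ω - R P (N B ξ Yp) t) *
          (Rhat (N B ξ Yp) (rho lam B) T s ω - R P (N B ξ Yp) s) ∂P =
      rho lam B ^ 2 * (∫ τ₂ in (0 : ℝ)..(T - s), ∫ τ₁ in (0 : ℝ)..(T - t),
        (H P' B Y (τ₁ - τ₂) * H P' B Y (τ₁ - τ₂ + t - s) +
          H P' B Y (τ₁ - τ₂ - s) * H P' B Y (τ₁ - τ₂ + t))) +
      rho lam B * (∫ τ₂ in (0 : ℝ)..(T - s), ∫ τ₁ in (0 : ℝ)..(T - t),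
        U P' B Y ![τ₁.toNNReal, (τ₁ + t).toNNReal, τ₂.toNNReal, (τ₂ + s).toNNReal]) := by
  have hle {t : ℝ} (htT : t < T) : 0 ≤ T - t := (sub_pos.2 htT).le
  rw [(h.hasCumulants hB hB' hB0 hN hs).integral_Rhat_sub_R_mul ht htT hs0 hsT,
    ← setIntegral_Icc_prod_Icc (hle htT) (hle hsT) (h.integrableOn_H_pairings hB hB' hB0 hN hs t s
      (isCompact_Icc.prod isCompact_Icc).measure_ne_top),
    ← setIntegral_Icc_prod_Icc (hle htT) (hle hsT) (h.integrableOn_U hB hB' hB0 hN hs ht hs0 _ _),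
    ← integral_const_mul, ← integral_const_mul]
  congr 2 with τ
  ring

theorem integral_sq_Rhat_sub_R_le (h : IsParticleSystem P P' lam Y ξ Yp) (hB : MeasurableSet B)
    (hB' : volume B ≠ ∞) (hB0 : volume B ≠ 0)
    (hN : AEMeasurable (fun p : ℝ × Ω => N B ξ Yp p.1.toNNReal p.2) (volume.prod P))
    (hs : IsCovarianceStationary P (N B ξ Yp)) {t T : ℝ} (ht : 0 ≤ t) (htT : t < T) :
    ∫ ω, |Rhat (N B ξ Yp) (rho lam B) T t ω - R P (N B ξ Yp) t| ^ 2 ∂P ≤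
      4 * (rho lam B ^ 2 + rho lam B) / (T - t) * ∫ y in (0 : ℝ)..T, H P' B Y y := by
  have hH := H_mem_Icc (P' := P') hB hB' hB0 h.measurable_generic h.generic_zero
  have hrho := h.rho_pos hB' hB0
  have : 0 < T - t := sub_pos.2 htT
  have hintH : 0 ≤ ∫ y in (0 : ℝ)..T, H P' B Y y :=
    intervalIntegral.integral_nonneg (ht.trans htT.le) fun y _ => (hH y).1
  have hcum := (h.hasCumulants hB hB' hB0 hN hs).integral_sq_Rhat_sub_R_le
    (fun x => mul_nonneg hrho.le (hH x).1)
    (fun s t u v => mul_le_mul_of_nonneg_left (h.U_four_le_H hB hB' hB0 hs s t u v) hrho.le) ht htT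
  rw [intervalIntegral.integral_const_mul] at hcum
  calc _ ≤ (4 * (rho lam B * H P' B Y 0) + 2) / (T - t) *
        (rho lam B * ∫ y in (0 : ℝ)..T, H P' B Y y) := hcum
    _ ≤ (4 * (rho lam B * 1) + 4) / (T - t) * (rho lam B * ∫ y in (0 : ℝ)..T, H P' B Y y) := by
        gcongr
        exacts [(hH 0).2, by norm_num]
    _ = 4 * (rho lam B ^ 2 + rho lam B) / (T - t) * ∫ y in (0 : ℝ)..T, H P' B Y y := by ring

end IsParticleSystem

end SmoluchowskiProcess

end Smoluchowski

theorem mainTheorem5_general {d : ℕ} {Ω : Type*} [MeasurableSpace Ω] {Ω' : Type*}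
    [MeasurableSpace Ω'] {P : Measure Ω} [IsProbabilityMeasure P] {P' : Measure Ω'}
    [IsProbabilityMeasure P'] {lam : ℝ≥0} {B : Set (EuclideanSpace ℝ (Fin d))}
    {Y : ℝ≥0 → Ω' → EuclideanSpace ℝ (Fin d)} {ξ : ℤ → Ω → EuclideanSpace ℝ (Fin d)}
    {Yp : ℤ → ℝ≥0 → Ω → EuclideanSpace ℝ (Fin d)} (hB : MeasurableSet B) (hB' : volume B ≠ ∞)
    (hB0 : volume B ≠ 0) (h : IsParticleSystem P P' lam Y ξ Yp)
    (hN : AEMeasurable (fun p : ℝ × Ω => N B ξ Yp p.1.toNNReal p.2) (volume.prod P))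
    (hs : IsCovarianceStationary P (N B ξ Yp)) (T : ℝ) :
    IntervalIntegrable (H P' B Y) volume 0 T ∧
    (∀ t : ℝ, 0 ≤ t → t < T →
      (∀ᵐ ω ∂P, IntervalIntegrable (empIntegrand (N B ξ Yp) (rho lam B) t ω)
        volume 0 (T - t)) ∧
      MemLp (fun ω => Rhat (N B ξ Yp) (rho lam B) T t ω - R P (N B ξ Yp) t) 2 P) ∧
    (∀ t s : ℝ, 0 ≤ t → t < T → 0 ≤ s → s < T →
      IntegrableOn (fun τ : ℝ × ℝ =>
          H P' B Y (τ.1 - τ.2) * H P' B Y (τ.1 - τ.2 + t - s) +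
            H P' B Y (τ.1 - τ.2 - s) * H P' B Y (τ.1 - τ.2 + t))
        (Set.Icc 0 (T - t) ×ˢ Set.Icc 0 (T - s)) volume ∧
      IntegrableOn (fun τ : ℝ × ℝ =>
          U P' B Y ![τ.1.toNNReal, (τ.1 + t).toNNReal, τ.2.toNNReal, (τ.2 + s).toNNReal])
        (Set.Icc 0 (T - t) ×ˢ Set.Icc 0 (T - s)) volume ∧
      (T - s) * (T - t) *
          ∫ ω, (Rhat (N B ξ Yp) (rho lam B) T t ω - R P (N B ξ Yp) t) *
            (Rhat (N B ξ Yp) (rho lam B) T s ω - R P (N B ξ Yp) s) ∂P =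
        rho lam B ^ 2 * (∫ τ₂ in (0 : ℝ)..(T - s), ∫ τ₁ in (0 : ℝ)..(T - t),
          (H P' B Y (τ₁ - τ₂) * H P' B Y (τ₁ - τ₂ + t - s) +
            H P' B Y (τ₁ - τ₂ - s) * H P' B Y (τ₁ - τ₂ + t))) +
        rho lam B * (∫ τ₂ in (0 : ℝ)..(T - s), ∫ τ₁ in (0 : ℝ)..(T - t),
          U P' B Y ![τ₁.toNNReal, (τ₁ + t).toNNReal, τ₂.toNNReal, (τ₂ + s).toNNReal])) ∧
    (∀ t : ℝ, 0 ≤ t → t < T →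
      ∫ ω, |Rhat (N B ξ Yp) (rho lam B) T t ω - R P (N B ξ Yp) t| ^ 2 ∂P ≤
        4 * (rho lam B ^ 2 + rho lam B) / (T - t) * ∫ y in (0 : ℝ)..T, H P' B Y y) := by
  have hfin (a b : ℝ) : volume (Set.Icc 0 a ×ˢ Set.Icc 0 b) ≠ ∞ :=
    (isCompact_Icc.prod isCompact_Icc).measure_ne_top
  have hcum := h.hasCumulants hB hB' hB0 hN hs
  exact ⟨h.intervalIntegrable_H hB hB' hB0 hN hs 0 T,
    fun t _ htT => ⟨hcum.ae_intervalIntegrable_empIntegrand htT.le, hcum.memLp_Rhat_sub_R htT⟩,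
    fun t s ht htT hs0 hsT => ⟨h.integrableOn_H_pairings hB hB' hB0 hN hs t s (hfin _ _),
      h.integrableOn_U hB hB' hB0 hN hs ht hs0 _ _,
      h.integral_Rhat_sub_R_mul hB hB' hB0 hN hs ht htT hs0 hsT⟩,
    fun t ht htT => h.integral_sq_Rhat_sub_R_le hB hB' hB0 hN hs ht htT⟩

theorem mainTheorem5 :
    ∃ C : ℝ, 0 < C ∧
    ∀ (d : ℕ) (Ω : Type*) [MeasurableSpace Ω] (Ω' : Type*) [MeasurableSpace Ω']
      (P : Measure Ω) [IsProbabilityMeasure P] (P' : Measure Ω') [IsProbabilityMeasure P']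
      (lam : ℝ≥0) (B : Set (EuclideanSpace ℝ (Fin d)))
      (Y : ℝ≥0 → Ω' → EuclideanSpace ℝ (Fin d))
      (ξ : ℤ → Ω → EuclideanSpace ℝ (Fin d))
      (Yp : ℤ → ℝ≥0 → Ω → EuclideanSpace ℝ (Fin d)),
      0 < lam → IsCompact B → (interior B).Nonempty →
      IsParticleSystem P P' lam Y ξ Yp →
      -- `N` is a measurable process, so that its time integrals make sense
      AEMeasurable (fun p : ℝ × Ω => N B ξ Yp p.1.toNNReal p.2) (volume.prod P) →
      IsStrictlyStationary P (N B ξ Yp) →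
      ∀ T : ℝ, 0 < T →
        -- the integrals below are integrals of integrable functions
        IntervalIntegrable (H P' B Y) volume 0 T ∧
        (∀ t : ℝ, 0 ≤ t → t < T →
          (∀ᵐ ω ∂P, IntervalIntegrable (empIntegrand (N B ξ Yp) (rho lam B) t ω)
            volume 0 (T - t)) ∧
          MemLp (fun ω => Rhat (N B ξ Yp) (rho lam B) T t ω - R P (N B ξ Yp) t) 2 P) ∧
        -- the covariance of the errors
        (∀ t s : ℝ, 0 ≤ t → t < T → 0 ≤ s → s < T →
          IntegrableOn (fun τ : ℝ × ℝ =>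
              H P' B Y (τ.1 - τ.2) * H P' B Y (τ.1 - τ.2 + t - s) +
                H P' B Y (τ.1 - τ.2 - s) * H P' B Y (τ.1 - τ.2 + t))
            (Set.Icc 0 (T - t) ×ˢ Set.Icc 0 (T - s)) volume ∧
          IntegrableOn (fun τ : ℝ × ℝ =>
              U P' B Y ![τ.1.toNNReal, (τ.1 + t).toNNReal, τ.2.toNNReal, (τ.2 + s).toNNReal])
            (Set.Icc 0 (T - t) ×ˢ Set.Icc 0 (T - s)) volume ∧
          (T - s) * (T - t) *
              ∫ ω, (Rhat (N B ξ Yp) (rho lam B) T t ω - R P (N B ξ Yp) t) *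
                (Rhat (N B ξ Yp) (rho lam B) T s ω - R P (N B ξ Yp) s) ∂P =
            rho lam B ^ 2 * (∫ τ₂ in (0 : ℝ)..(T - s), ∫ τ₁ in (0 : ℝ)..(T - t),
              (H P' B Y (τ₁ - τ₂) * H P' B Y (τ₁ - τ₂ + t - s) +
                H P' B Y (τ₁ - τ₂ - s) * H P' B Y (τ₁ - τ₂ + t))) +
            rho lam B * (∫ τ₂ in (0 : ℝ)..(T - s), ∫ τ₁ in (0 : ℝ)..(T - t),
              U P' B Y ![τ₁.toNNReal, (τ₁ + t).toNNReal, τ₂.toNNReal, (τ₂ + s).toNNReal])) ∧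
        -- the mean squared error
        (∀ t : ℝ, 0 ≤ t → t < T →
          ∫ ω, |Rhat (N B ξ Yp) (rho lam B) T t ω - R P (N B ξ Yp) t| ^ 2 ∂P ≤
            C * (rho lam B ^ 2 + rho lam B) / (T - t) * ∫ y in (0 : ℝ)..T, H P' B Y y) := by
  refine ⟨4, by norm_num, fun d Ω _ Ω' _ P _ P' _ lam B Y ξ Yp _ hBc hBi h hN hs T _ => ?_⟩
  exact mainTheorem5_general hBc.measurableSet hBc.measure_ne_top
    (Measure.measure_pos_of_nonempty_interior volume hBi).ne' h hN hs.isCovarianceStationary T
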